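/- Let $\Omega=(0,\pi)^2$ and let $g,\bar h>0$ be constants. For a function $u$ on $\Omega$ let $\tilde u$ be its extension to $\mathbb R^2$ that is odd and $2\pi$-periodic in each of the two variables, and for a kernel $\varphi\in L^1(\mathbb R^2)$ put $$(\varphi*u)(x,y)=\iint_{\mathbb R^2}\varphi(\xi,\zeta)\,\tilde u(x-\xi,y-\zeta)\,d\xi\,d\zeta .$$ Consider the modified damped wave equation (the linearized error equation) $$u_{tt}=(g\bar h\,\delta_0+\bar h\,\varphi_v)*\Delta u-\varphi_h*u_t\quad\text{in }\Omega,\ t\ge 0,\qquad u=0\ \text{on }\partial\Omega .\tag{1}$$ A solution of (1) is a function $u\in C([0,\infty);H^1_0(\Omega))\cap C^1([0,\infty);L^2(\Omega))$ that satisfies the equation in the sense of distributions on $\Omega$, with $\varphi_v*\Delta u=\Delta(\varphi_v*u)$: for all $v\in C_c^\infty(\Omega)$ and $t\ge0$, $$\frac{d}{dt}\int_\Omega u_t(t)\,v=\int_\Omega \bigl(g\bar h\,u(t)+\bar h\,\varphi_v*u(t)\bigr)\Delta v-\int_\Omega(\varphi_h*u_t(t))\,v .$$ On $\mathcal H=H^1(\Omega)\times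 L^2(\Omega)$ put $\|(u,w)\|_{\mathcal H}=\left(\int_\Omega|\nabla u|^2+|w|^2\right)^{1/2}$. Equation (1) is called strongly asymptotically stable if $\lim_{t\to\infty}\|(u(t),u_t(t))\|_{\mathcal H}=0$ for every solution $u$ of (1). (a) If $\varphi_v(x,y)=\beta_v e^{-\alpha_v(x^2+y^2)}$ and $\varphi_h(x,y)=\beta_h e^{-\alpha_h(x^2+y^2)}$ with $\alpha_v,\beta_v,\alpha_h,\beta_h>0$, then (1) is strongly asymptotically stable. (b) More generally, let $f,k:\mathbb R\to\mathbb R$ be even and integrable, and let $\varphi_v(x,y)=(f*f)(x)\,(f*f)(y)$ and $\varphi_h(x,y)=(k*k)(x)\,(k*k)(y)$, with convolution on $\mathbb R$. If the Fourier coefficients $\frac1{(2\pi)^2}\iint_{\mathbb R^2}\varphi_h(x,y)\cos(px)\cos(qy)\,dx\,dy$ are positive for all integers $p,q\ge1$, then (1) is strongly asymptotically stable. (For $\varphi_v$ these coefficients are automatically nonnegative, and no further condition is needed. Periodic kernel factors with convolution over a period are included: take $f$, $k$ to be their restrictions to $(-\pi,\pi)$, extended by zero.) -/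

import Mathlib

open MeasureTheory Filter Topology Set
open scoped ContDiff

noncomputable section

namespace WaveObserver

/-- The (open) square `Ω = (0, π)²`. -/
def Omega : Set (ℝ × ℝ) := Ioo 0 Real.pi ×ˢ Ioo 0 Real.pi

/-- The real Hilbert space `L²(Ω)`. -/
abbrev L2 : Type := Lp ℝ 2 (volume.restrict Omega)

/-- `∂v/∂x`. -/
def dx (v : ℝ × ℝ → ℝ) (z : ℝ × ℝ) : ℝ := deriv (fun s => v (s, z.2)) z.1

/-- `∂v/∂y`. -/
def dy (v : ℝ × ℝ → ℝ) (z : ℝ × ℝ) : ℝ := deriv (fun s => v (z.1, s)) z.2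

/-- The Laplacian `∂²v/∂x² + ∂²v/∂y²`. -/
def lap (v : ℝ × ℝ → ℝ) (z : ℝ × ℝ) : ℝ := dx (dx v) z + dy (dy v) z

/-- Test functions: `v ∈ C_c^∞(Ω)`. -/
def IsTest (v : ℝ × ℝ → ℝ) : Prop :=
  ContDiff ℝ ∞ v ∧ HasCompactSupport v ∧ tsupport v ⊆ Omega

/-- The Sobolev space `H¹₀(Ω)`, the closure of `C_c^∞(Ω)` for the `H¹` norm. An element `u` is
represented by the triple `(u, ∂u/∂x, ∂u/∂y)` in `L²(Ω)³`, so that the topology is that of `H¹`. -/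
def H10 : Set (L2 × L2 × L2) :=
  closure {U | ∃ v : ℝ × ℝ → ℝ, IsTest v ∧
    U.1 =ᵐ[volume.restrict Omega] v ∧
    U.2.1 =ᵐ[volume.restrict Omega] dx v ∧
    U.2.2 =ᵐ[volume.restrict Omega] dy v}

/-- The representative of `x` modulo `2π` in `[-π, π)`. -/
def fold (x : ℝ) : ℝ := toIcoMod Real.two_pi_pos (-Real.pi) x

/-- The extension of a function on `Ω` to the plane that is odd and `2π`-periodic in each of the two
variables (the extension through the sine series). -/
def oddExt (u : ℝ × ℝ → ℝ) (z : ℝ × ℝ) : ℝ :=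
  Real.sign (fold z.1) * Real.sign (fold z.2) * u (|fold z.1|, |fold z.2|)

/-- The convolution `φ * u` of a kernel on the plane with a function on `Ω`:
`(φ * u)(z) = ∬ φ(ζ) ũ(z - ζ) dζ`, where `ũ` is the odd `2π`-periodic extension of `u`. -/
def conv (φ : ℝ × ℝ → ℝ) (u : ℝ × ℝ → ℝ) : ℝ × ℝ → ℝ :=
  convolution φ (oddExt u) (ContinuousLinearMap.mul ℝ ℝ) volume

/-- `(u, w)`, with `w = u_t`, is a solution on `[0, ∞)` of the error equation
`u_tt = (grav · hbar · δ₀ + hbar · φv) * Δu - φh * u_t` in `Ω`, with `u = 0` on the boundary, in the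
class `C([0, ∞); H¹₀(Ω)) ∩ C¹([0, ∞); L²(Ω))`. Here `U t` is the triple `(u, ∂u/∂x, ∂u/∂y)` at time
`t`, and the equation is meant in the sense of distributions on `Ω`, with
`φv * Δu = Δ(φv * u)`. -/
structure IsErrorSolution (grav hbar : ℝ) (φv φh : ℝ × ℝ → ℝ)
    (U : ℝ → L2 × L2 × L2) (w : ℝ → L2) : Prop where
  mem_H10 : ∀ t, 0 ≤ t → U t ∈ H10
  continuousOn_U : ContinuousOn U (Ici 0)
  continuousOn_w : ContinuousOn w (Ici 0)
  hasDeriv : ∀ t, 0 ≤ t → HasDerivWithinAt (fun s => (U s).1) (w t) (Ici 0) t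
  equation : ∀ v : ℝ × ℝ → ℝ, IsTest v → ∀ t, 0 ≤ t →
    HasDerivWithinAt (fun s => ∫ z in Omega, w s z * v z)
      ((∫ z in Omega, (grav * hbar * (U t).1 z + hbar * conv φv (U t).1 z) * lap v z)
        - ∫ z in Omega, conv φh (w t) z * v z)
      (Ici 0) t

/-- The norm `(∫_Ω |∇u|² + |w|²)^{1/2}` of `(u, w)`. -/
def normH (U : L2 × L2 × L2) (w : L2) : ℝ :=
  Real.sqrt (∫ z in Omega, ((U.2.1 z) ^ 2 + (U.2.2 z) ^ 2 + (w z) ^ 2))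

/-- All solutions of the error equation with kernels `φv`, `φh` tend strongly to zero. -/
def StronglyAsymptoticallyStable (grav hbar : ℝ) (φv φh : ℝ × ℝ → ℝ) : Prop :=
  ∀ (U : ℝ → L2 × L2 × L2) (w : ℝ → L2), IsErrorSolution grav hbar φv φh U w →
    Tendsto (fun t => normH (U t) (w t)) atTop (𝓝 0)

/-- The Gaussian kernel `β exp(-α (x² + y²))`. -/
def gaussianKernel (α β : ℝ) (z : ℝ × ℝ) : ℝ :=
  β * Real.exp (-α * (z.1 ^ 2 + z.2 ^ 2))

/-- The kernel `(f * f)(x) (f * f)(y)`. -/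
def squareKernel (f : ℝ → ℝ) (z : ℝ × ℝ) : ℝ :=
  convolution f f (ContinuousLinearMap.mul ℝ ℝ) volume z.1 *
    convolution f f (ContinuousLinearMap.mul ℝ ℝ) volume z.2

/-- The Fourier coefficient of index `(p, q)` of (the `2π`-periodization of) a kernel that is even
in each of its variables. -/
def kernelCoeff (φ : ℝ × ℝ → ℝ) (p q : ℕ) : ℝ :=
  1 / (2 * Real.pi) ^ 2 * ∫ z : ℝ × ℝ, φ z * (Real.cos (p * z.1) * Real.cos (q * z.2))

end WaveObserver

end

/-!
The sine functions `sin(px) sin(qy)`, `p, q ≥ 1`, diagonalize the equation: they are the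
eigenfunctions of the Dirichlet Laplacian, with eigenvalues `p² + q²`, and a kernel `φ` which is
even in each variable acts on them by convolution as multiplication by its symbol
`∬ φ(x, y) cos(px) cos(qy)` (`conv_sinMode`). So every sine coefficient of a solution is a damped
oscillator `a'' = -c a - d a'` with `c = (p² + q²)(grav hbar + hbar symbol φv)` and
`d = symbol φh`. Here `c > 0` because the symbol of `φv` is nonnegative, and `d > 0` by hypothesis,
so the energy `c a² + a'²` of each mode decreases to zero. The sum over the modes of these energies
is equivalent to `‖(u, u_t)‖²`; each term is bounded by its value at time zero, and these values are
summable, so the sum tends to zero by dominated convergence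
(`stronglyAsymptoticallyStable_of_symbol`).

The work lies in justifying this for weak solutions.

* Completeness of the sine functions in `L²(Ω)` (`eq_zero_of_inner_sinL2_eq_zero`) follows from the
  Stone–Weierstrass theorem: their span is stable under multiplication by `cos x` and `cos y`, which
  separate the points of `[0, π]²`.
* On `H¹₀(Ω)` the sum `∑ (p² + q²) a²` is equivalent to `∫ |∇u|²`; this is Green's formula and
  Parseval's identity for test functions, extended to the closure.
* The pairing `∫_Ω (φ * u) ψ` is continuous in `u` for the `L²` norm (`exists_convCLM`), so it can
  be computed on the sine basis (`hasSum_conv`).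
* The equation is given for test functions only, and the sine functions are not compactly supported
  in `Ω`. They belong to `H¹₀(Ω)` (`smoothTriple_sinMode_mem_H10`), and the right-hand side of the
  equation, expanded in the sine basis, is continuous in the test function for the `H¹` norm
  (`abs_rhs_sub_le`).

For the Gaussian kernels the symbols are positive by the Fourier transform of the Gaussian, and the
symbol of `(f * f)(x) (f * f)(y)` is a product of squares of cosine transforms of `f`.
-/

open MeasureTheory Filter Topology Set
open scoped ContDiff

noncomputable section

namespace WaveObserver

/-! ### A damped oscillator -/

theorem oscillator_energy_antitoneOn {c d : ℝ} (hd : 0 < d) {a b : ℝ → ℝ}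
    (ha : ContinuousOn a (Ici 0)) (hb : ContinuousOn b (Ici 0))
    (hda : ∀ t, 0 < t → HasDerivAt a (b t) t)
    (hdb : ∀ t, 0 < t → HasDerivAt b (-(c * a t) - d * b t) t) :
    AntitoneOn (fun t => c * a t ^ 2 + b t ^ 2) (Ici 0) := by
  have hder : ∀ t, 0 < t → HasDerivAt (fun t => c * a t ^ 2 + b t ^ 2) (-2 * d * b t ^ 2) t := by
    intro t ht
    refine ((((hda t ht).pow 2).const_mul c).add ((hdb t ht).pow 2)).congr_deriv ?_
    push_cast
    ring
  refine antitoneOn_of_deriv_nonpos (convex_Ici 0) (by fun_prop) ?_ ?_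
  · intro t ht
    rw [interior_Ici] at ht
    exact (hder t ht).differentiableAt.differentiableWithinAt
  · intro t ht
    rw [interior_Ici] at ht
    rw [(hder t ht).deriv]
    nlinarith [sq_nonneg (b t)]

theorem oscillator_energy_tendsto_zero {c d : ℝ} (hc : 0 < c) (hd : 0 < d) {a b : ℝ → ℝ}
    (ha : ContinuousOn a (Ici 0)) (hb : ContinuousOn b (Ici 0))
    (hda : ∀ t, 0 < t → HasDerivAt a (b t) t)
    (hdb : ∀ t, 0 < t → HasDerivAt b (-(c * a t) - d * b t) t) :
    Tendsto (fun t => c * a t ^ 2 + b t ^ 2) atTop (𝓝 0) := by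
  -- For small `ε` the cross term makes `c a² + b² + ε a b` a strict Lyapunov function.
  obtain ⟨ε, hε, hε1, hε2⟩ : ∃ ε : ℝ, 0 < ε ∧ ε * (1 + d ^ 2 / (2 * c)) ≤ d ∧ ε ^ 2 ≤ c := by
    have h1 : 0 < 1 + d ^ 2 / (2 * c) := by positivity
    refine ⟨min (d / (1 + d ^ 2 / (2 * c))) (Real.sqrt c), ?_, ?_, ?_⟩
    · exact lt_min (by positivity) (Real.sqrt_pos.2 hc)
    · rw [← le_div_iff₀ h1]
      exact min_le_left _ _
    · have h0 : 0 ≤ min (d / (1 + d ^ 2 / (2 * c))) (Real.sqrt c) :=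
        le_min (by positivity) (Real.sqrt_nonneg c)
      calc _ ≤ (Real.sqrt c) ^ 2 := pow_le_pow_left₀ h0 (min_le_right _ _) 2
        _ = c := Real.sq_sqrt hc.le
  set κ : ℝ := min d (ε / 2) with hκ
  have hκ0 : 0 < κ := lt_min hd (by positivity)
  have cross : ∀ x y : ℝ, |ε * x * y| ≤ (c * x ^ 2 + y ^ 2) / 2 := by
    intro x y
    rw [abs_le]
    constructor <;> nlinarith [sq_nonneg (ε * x + y), sq_nonneg (ε * x - y),
      mul_le_mul_of_nonneg_right hε2 (sq_nonneg x)]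
  have decay : ∀ x y : ℝ, -2 * d * y ^ 2 + ε * y ^ 2 - ε * c * x ^ 2 - ε * d * x * y
      ≤ -(2 * κ / 3) * (c * x ^ 2 + y ^ 2 + ε * x * y) := by
    intro x y
    have h1 : ε * y ^ 2 - ε * d * x * y ≤ d * y ^ 2 + ε * c * x ^ 2 / 2 := by
      have h2 : 0 ≤ ε * (c * x + d * y) ^ 2 / (2 * c) := by positivity
      have h3 : ε * (c * x + d * y) ^ 2 / (2 * c)
          = ε * c * x ^ 2 / 2 + ε * d * x * y + ε * (d ^ 2 / (2 * c)) * y ^ 2 := by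
        field_simp
        ring
      nlinarith [mul_le_mul_of_nonneg_right hε1 (sq_nonneg y)]
    have h2 : κ * (c * x ^ 2 + y ^ 2) ≤ d * y ^ 2 + ε / 2 * (c * x ^ 2) := by
      have := mul_le_mul_of_nonneg_right (min_le_left d (ε / 2)) (sq_nonneg y)
      have := mul_le_mul_of_nonneg_right (min_le_right d (ε / 2))
        (mul_nonneg hc.le (sq_nonneg x))
      linarith
    have h3 := mul_le_mul_of_nonneg_left (abs_le.1 (cross x y)).2 hκ0.le
    linarith
  set V : ℝ → ℝ := fun t => c * a t ^ 2 + b t ^ 2 + ε * a t * b t with hV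
  have hderV : ∀ t, 0 < t → HasDerivAt V (-2 * d * b t ^ 2 + ε * b t ^ 2 - ε * c * a t ^ 2
      - ε * d * a t * b t) t := by
    intro t ht
    refine (((((hda t ht).pow 2).const_mul c).add ((hdb t ht).pow 2)).add
      (((hda t ht).const_mul ε).mul (hdb t ht))).congr_deriv ?_
    push_cast
    ring
  have hanti : AntitoneOn (fun t => Real.exp (2 * κ / 3 * t) * V t) (Ici 0) := by
    have hder : ∀ t, 0 < t → HasDerivAt (fun t => Real.exp (2 * κ / 3 * t) * V t)
        (Real.exp (2 * κ / 3 * t) * (2 * κ / 3 * 1) * V t + Real.exp (2 * κ / 3 * t) *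
          (-2 * d * b t ^ 2 + ε * b t ^ 2 - ε * c * a t ^ 2 - ε * d * a t * b t)) t := by
      intro t ht
      exact (((hasDerivAt_id t).const_mul (2 * κ / 3)).exp).mul (hderV t ht)
    refine antitoneOn_of_deriv_nonpos (convex_Ici 0) (by fun_prop) ?_ ?_
    · intro t ht
      rw [interior_Ici] at ht
      exact (hder t ht).differentiableAt.differentiableWithinAt
    · intro t ht
      rw [interior_Ici] at ht
      rw [(hder t ht).deriv]
      have := mul_le_mul_of_nonneg_left (decay (a t) (b t)) (Real.exp_pos (2 * κ / 3 * t)).le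
      simp only [hV]
      linarith
  have hbound : ∀ t, 0 ≤ t → c * a t ^ 2 + b t ^ 2 ≤ 2 * V 0 * Real.exp (-(2 * κ / 3 * t)) := by
    intro t ht
    have h1 := hanti (mem_Ici.2 le_rfl) (mem_Ici.2 ht) ht
    simp only [mul_zero, Real.exp_zero, one_mul] at h1
    have h2 : V t ≤ V 0 * Real.exp (-(2 * κ / 3 * t)) := by
      rw [Real.exp_neg, ← div_eq_mul_inv, le_div_iff₀ (Real.exp_pos _), mul_comm]
      exact h1
    have h3 := (abs_le.1 (cross (a t) (b t))).1
    have h4 : V t = c * a t ^ 2 + b t ^ 2 + ε * a t * b t := rfl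
    linarith
  have hlim : Tendsto (fun t => 2 * V 0 * Real.exp (-(2 * κ / 3 * t))) atTop (𝓝 0) := by
    have h1 : Tendsto (fun t : ℝ => 2 * κ / 3 * t) atTop atTop :=
      tendsto_id.const_mul_atTop (by positivity)
    simpa using (Real.tendsto_exp_neg_atTop_nhds_zero.comp h1).const_mul (2 * V 0)
  refine tendsto_of_tendsto_of_tendsto_of_le_of_le' tendsto_const_nhds hlim ?_ ?_
  · exact Eventually.of_forall fun t => by positivity
  · filter_upwards [eventually_ge_atTop 0] with t ht using hbound t ht

/-! ### The sine basis of `L²(Ω)` -/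

instance : IsFiniteMeasure (volume.restrict Omega) := by
  refine ⟨?_⟩
  rw [Measure.restrict_apply_univ, Omega, Measure.volume_eq_prod, Measure.prod_prod]
  simp [ENNReal.mul_lt_top]

theorem isOpen_Omega : IsOpen Omega := isOpen_Ioo.prod isOpen_Ioo

theorem measurableSet_Omega : MeasurableSet Omega := isOpen_Omega.measurableSet

theorem volume_restrict_Omega : (volume.restrict Omega : Measure (ℝ × ℝ)) =
    (volume.restrict (Ioo 0 Real.pi)).prod (volume.restrict (Ioo 0 Real.pi)) := by
  rw [Omega, Measure.volume_eq_prod, Measure.prod_restrict]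

theorem integral_Omega_mul (f g : ℝ → ℝ) :
    ∫ z in Omega, f z.1 * g z.2 = (∫ x in (0)..Real.pi, f x) * ∫ y in (0)..Real.pi, g y := by
  rw [volume_restrict_Omega, integral_prod_mul, intervalIntegral.integral_of_le Real.pi_pos.le,
    intervalIntegral.integral_of_le Real.pi_pos.le, integral_Ioc_eq_integral_Ioo,
    integral_Ioc_eq_integral_Ioo]

theorem inner_L2_eq (f g : L2) : inner ℝ f g = ∫ z in Omega, f z * g z := by
  rw [MeasureTheory.L2.inner_def]
  refine integral_congr_ae (Eventually.of_forall fun z => ?_)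
  simp [mul_comm]

theorem memLp_Omega_of_continuous {f : ℝ × ℝ → ℝ} (hf : Continuous f) :
    MemLp f 2 (volume.restrict Omega) := by
  obtain ⟨C, hC⟩ := (isCompact_Icc.prod isCompact_Icc :
    IsCompact (Icc 0 Real.pi ×ˢ Icc 0 Real.pi)).exists_bound_of_continuousOn hf.continuousOn
  refine MemLp.of_bound hf.aestronglyMeasurable C ?_
  filter_upwards [ae_restrict_mem measurableSet_Omega] with z hz
  exact hC z ⟨Ioo_subset_Icc_self hz.1, Ioo_subset_Icc_self hz.2⟩

/-- The normalized sine function `(2/π) sin(px) sin(qy)` on the plane, where `p = k.1 + 1` and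
`q = k.2 + 1`, so that the positive frequencies are indexed by `ℕ × ℕ`. -/
def sinMode (k : ℕ × ℕ) (z : ℝ × ℝ) : ℝ :=
  2 / Real.pi * (Real.sin ((k.1 + 1 : ℕ) * z.1) * Real.sin ((k.2 + 1 : ℕ) * z.2))

theorem contDiff_sinMode (k : ℕ × ℕ) : ContDiff ℝ ∞ (sinMode k) := by
  unfold sinMode
  fun_prop

theorem continuous_sinMode (k : ℕ × ℕ) : Continuous (sinMode k) := (contDiff_sinMode k).continuous

/-- The sine function `sinMode k` as an element of `L²(Ω)`. -/
def sinL2 (k : ℕ × ℕ) : L2 := (memLp_Omega_of_continuous (continuous_sinMode k)).toLp (sinMode k)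

theorem coeFn_sinL2 (k : ℕ × ℕ) : sinL2 k =ᵐ[volume.restrict Omega] sinMode k :=
  MemLp.coeFn_toLp _

theorem inner_sinL2 (k : ℕ × ℕ) (f : L2) :
    inner ℝ (sinL2 k) f = ∫ z in Omega, f z * sinMode k z := by
  rw [inner_L2_eq]
  refine integral_congr_ae ?_
  filter_upwards [coeFn_sinL2 k] with z hz
  rw [hz, mul_comm]

theorem integral_cos_int_mul (j : ℤ) :
    ∫ x in (0)..Real.pi, Real.cos (j * x) = if j = 0 then Real.pi else 0 := by
  split_ifs with h
  · simp [h]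
  · have hj : (j : ℝ) ≠ 0 := by exact_mod_cast h
    rw [intervalIntegral.integral_comp_mul_left (fun x => Real.cos x) hj, integral_cos]
    simp [Real.sin_int_mul_pi]

theorem integral_sin_mul_sin_nat (m n : ℕ) (hm : 1 ≤ m) :
    ∫ x in (0)..Real.pi, Real.sin (m * x) * Real.sin (n * x) =
      if m = n then Real.pi / 2 else 0 := by
  have h1 : ∀ x : ℝ, Real.sin (m * x) * Real.sin (n * x) =
      (Real.cos (((m - n : ℤ) : ℝ) * x) - Real.cos (((m + n : ℤ) : ℝ) * x)) / 2 := by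
    intro x
    push_cast
    rw [sub_mul, add_mul, Real.cos_sub, Real.cos_add]
    ring
  simp_rw [h1]
  rw [intervalIntegral.integral_div, intervalIntegral.integral_sub
    (Continuous.intervalIntegrable (by fun_prop) _ _)
    (Continuous.intervalIntegrable (by fun_prop) _ _), integral_cos_int_mul, integral_cos_int_mul]
  have h2 : ((m : ℤ) + n = 0) ↔ False := by exact iff_of_false (by omega) not_false
  have h3 : ((m : ℤ) - n = 0) ↔ m = n := by constructor <;> intro h <;> omega
  simp only [h2, h3, if_false]
  split_ifs <;> simp

theorem orthonormal_sinL2 : Orthonormal ℝ sinL2 := by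
  rw [orthonormal_iff_ite]
  intro k l
  have h1 : inner ℝ (sinL2 k) (sinL2 l) = ∫ z in Omega,
      ((2 / Real.pi) * (Real.sin ((l.1 + 1 : ℕ) * z.1) * Real.sin ((k.1 + 1 : ℕ) * z.1))) *
        ((2 / Real.pi) * (Real.sin ((l.2 + 1 : ℕ) * z.2) * Real.sin ((k.2 + 1 : ℕ) * z.2))) := by
    rw [inner_sinL2]
    refine integral_congr_ae ?_
    filter_upwards [coeFn_sinL2 l] with z hz
    rw [hz, sinMode, sinMode]
    ring
  rw [h1, integral_Omega_mul (fun x => (2 / Real.pi) *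
      (Real.sin ((l.1 + 1 : ℕ) * x) * Real.sin ((k.1 + 1 : ℕ) * x)))
    (fun x => (2 / Real.pi) * (Real.sin ((l.2 + 1 : ℕ) * x) * Real.sin ((k.2 + 1 : ℕ) * x))),
    intervalIntegral.integral_const_mul, intervalIntegral.integral_const_mul,
    integral_sin_mul_sin_nat _ _ (by omega), integral_sin_mul_sin_nat _ _ (by omega)]
  have h2 : (k = l) ↔ (l.1 + 1 = k.1 + 1 ∧ l.2 + 1 = k.2 + 1) := by
    rw [Prod.ext_iff]; omega
  have := Real.pi_ne_zero
  simp only [h2]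
  split_ifs <;> first | (exfalso; tauto) | simp

/-- The trigonometric polynomials spanned by the sine functions `sinMode k`. -/
def sinSpan : Submodule ℝ (ℝ × ℝ → ℝ) := Submodule.span ℝ (range sinMode)

theorem sin_mul_cos_sum (p : ℕ) (x : ℝ) : Real.cos x * Real.sin ((p + 1 : ℕ) * x) =
    (Real.sin ((p + 1 + 1 : ℕ) * x) + Real.sin (p * x)) / 2 := by
  have h1 : ((p + 1 + 1 : ℕ) : ℝ) * x = (p + 1 : ℕ) * x + x := by push_cast; ring
  have h2 : (p : ℝ) * x = (p + 1 : ℕ) * x - x := by push_cast; ring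
  rw [h1, h2, Real.sin_add, Real.sin_sub]
  ring

theorem mul_mem_sinSpan {h : ℝ × ℝ → ℝ} (hh : ∀ k, h * sinMode k ∈ sinSpan) {v : ℝ × ℝ → ℝ}
    (hv : v ∈ sinSpan) : h * v ∈ sinSpan := by
  induction hv using Submodule.span_induction with
  | mem v hv => obtain ⟨k, rfl⟩ := hv; exact hh k
  | zero => rw [mul_zero]; exact zero_mem _
  | add v w _ _ hv hw => rw [mul_add]; exact add_mem hv hw
  | smul c v _ hv => rw [mul_smul_comm]; exact Submodule.smul_mem _ c hv

/-- Multiplication by `cos x` shifts the frequency `p` by `±1`; the frequency `0` which arises from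
`p = 1` contributes nothing. -/
theorem cos_fst_mul_mem_sinSpan {v : ℝ × ℝ → ℝ} (hv : v ∈ sinSpan) :
    (fun z : ℝ × ℝ => Real.cos z.1) * v ∈ sinSpan := by
  refine mul_mem_sinSpan (fun k => ?_) hv
  have hmem : ∀ l, sinMode l ∈ sinSpan := fun l => Submodule.subset_span (mem_range_self l)
  obtain ⟨p, q⟩ := k
  have h1 : (fun z : ℝ × ℝ => Real.cos z.1) * sinMode (p, q) = fun z => 2 / Real.pi *
      ((Real.sin ((p + 1 + 1 : ℕ) * z.1) + Real.sin (p * z.1)) / 2 *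
        Real.sin ((q + 1 : ℕ) * z.2)) := by
    funext z
    rw [← sin_mul_cos_sum]
    simp only [Pi.mul_apply, sinMode]
    ring
  rw [h1]
  cases p with
  | zero =>
    convert Submodule.smul_mem _ (1 / 2 : ℝ) (hmem (1, q)) using 1
    funext z
    simp [sinMode]
    ring
  | succ p =>
    convert Submodule.smul_mem _ (1 / 2 : ℝ) (add_mem (hmem (p + 2, q)) (hmem (p, q))) using 1
    funext z
    simp only [Pi.smul_apply, Pi.add_apply, sinMode, smul_eq_mul]
    ring

theorem cos_snd_mul_mem_sinSpan {v : ℝ × ℝ → ℝ} (hv : v ∈ sinSpan) :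
    (fun z : ℝ × ℝ => Real.cos z.2) * v ∈ sinSpan := by
  refine mul_mem_sinSpan (fun k => ?_) hv
  have hmem : ∀ l, sinMode l ∈ sinSpan := fun l => Submodule.subset_span (mem_range_self l)
  obtain ⟨p, q⟩ := k
  have h1 : (fun z : ℝ × ℝ => Real.cos z.2) * sinMode (p, q) = fun z => 2 / Real.pi *
      (Real.sin ((p + 1 : ℕ) * z.1) *
        ((Real.sin ((q + 1 + 1 : ℕ) * z.2) + Real.sin (q * z.2)) / 2)) := by
    funext z
    rw [← sin_mul_cos_sum]
    simp only [Pi.mul_apply, sinMode]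
    ring
  rw [h1]
  cases q with
  | zero =>
    convert Submodule.smul_mem _ (1 / 2 : ℝ) (hmem (p, 1)) using 1
    funext z
    simp [sinMode]
    ring
  | succ q =>
    convert Submodule.smul_mem _ (1 / 2 : ℝ) (add_mem (hmem (p, q + 2)) (hmem (p, q))) using 1
    funext z
    simp only [Pi.smul_apply, Pi.add_apply, sinMode, smul_eq_mul]
    ring

/-- The continuous functions by which the span of the sine functions is stable under
multiplication. It contains `cos x` and `cos y`, which separate the points of `[0, π]²`. -/
def sinMultiplier : Subalgebra ℝ C(ℝ × ℝ, ℝ) where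
  carrier := {h | ∀ v ∈ sinSpan, ⇑h * v ∈ sinSpan}
  mul_mem' {a b} ha hb v hv := by
    rw [ContinuousMap.coe_mul, mul_assoc]
    exact ha _ (hb _ hv)
  add_mem' {a b} ha hb v hv := by
    rw [ContinuousMap.coe_add, add_mul]
    exact add_mem (ha _ hv) (hb _ hv)
  algebraMap_mem' r v hv := by
    have : ⇑(algebraMap ℝ C(ℝ × ℝ, ℝ) r) * v = r • v := by
      funext z
      simp
    rw [this]
    exact Submodule.smul_mem _ r hv

theorem exists_sinMultiplier_near {g : ℝ × ℝ → ℝ} (hg : Continuous g) {ε : ℝ} (hε : 0 < ε) :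
    ∃ h ∈ sinMultiplier, ∀ z ∈ Omega, |h z - g z| < ε := by
  let ι : C(Icc 0 Real.pi × Icc 0 Real.pi, ℝ × ℝ) :=
    ⟨fun z => ((z.1 : ℝ), (z.2 : ℝ)), by fun_prop⟩
  let A : Subalgebra ℝ C(Icc 0 Real.pi × Icc 0 Real.pi, ℝ) :=
    sinMultiplier.map (ContinuousMap.compRightAlgHom ℝ ℝ ι)
  have hA : A.SeparatesPoints := by
    intro z w hzw
    have hne : z.1 ≠ w.1 ∨ z.2 ≠ w.2 := by
      by_contra! hcon
      exact hzw (Prod.ext hcon.1 hcon.2)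
    rcases hne with hne | hne
    · refine ⟨_, ⟨_, ⟨⟨fun z : ℝ × ℝ => Real.cos z.1, by fun_prop⟩,
        fun v hv => cos_fst_mul_mem_sinSpan hv, rfl⟩, rfl⟩, fun heq => hne ?_⟩
      exact Subtype.ext (Real.injOn_cos z.1.2 w.1.2 heq)
    · refine ⟨_, ⟨_, ⟨⟨fun z : ℝ × ℝ => Real.cos z.2, by fun_prop⟩,
        fun v hv => cos_snd_mul_mem_sinSpan hv, rfl⟩, rfl⟩, fun heq => hne ?_⟩
      exact Subtype.ext (Real.injOn_cos z.2.2 w.2.2 heq)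
  obtain ⟨⟨_, ⟨h, hh, rfl⟩⟩, happ⟩ :=
    ContinuousMap.exists_mem_subalgebra_near_continuous_of_separatesPoints A hA
      (fun z => g (ι z)) (by fun_prop) ε hε
  refine ⟨h, hh, fun z hz => ?_⟩
  exact happ (⟨z.1, Ioo_subset_Icc_self hz.1⟩, ⟨z.2, Ioo_subset_Icc_self hz.2⟩)

theorem integrable_L2_mul {f : L2} {g : ℝ × ℝ → ℝ} (hg : MemLp g 2 (volume.restrict Omega)) :
    Integrable (fun z => f z * g z) (volume.restrict Omega) :=
  (Lp.memLp f).integrable_mul hg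

theorem integral_mul_sinSpan_eq_zero {f : L2} (hf : ∀ k, inner ℝ (sinL2 k) f = 0)
    {v : ℝ × ℝ → ℝ} (hv : v ∈ sinSpan) : Continuous v ∧ ∫ z in Omega, f z * v z = 0 := by
  induction hv using Submodule.span_induction with
  | mem v hv =>
    obtain ⟨k, rfl⟩ := hv
    exact ⟨continuous_sinMode k, by rw [← inner_sinL2, hf k]⟩
  | zero => exact ⟨continuous_zero, by simp⟩
  | add v w _ _ hv hw =>
    refine ⟨hv.1.add hw.1, ?_⟩
    simp only [Pi.add_apply, mul_add]
    rw [integral_add (integrable_L2_mul (memLp_Omega_of_continuous hv.1))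
      (integrable_L2_mul (memLp_Omega_of_continuous hw.1)), hv.2, hw.2, add_zero]
  | smul c v _ hv =>
    refine ⟨hv.1.const_smul c, ?_⟩
    simp only [Pi.smul_apply, smul_eq_mul, mul_left_comm _ c]
    rw [integral_const_mul, hv.2, mul_zero]

theorem sinMode_zero_pos {z : ℝ × ℝ} (hz : z ∈ Omega) : 0 < sinMode (0, 0) z := by
  have h1 := Real.sin_pos_of_mem_Ioo hz.1
  have h2 := Real.sin_pos_of_mem_Ioo hz.2
  have := Real.pi_pos
  simp only [sinMode, zero_add, Nat.cast_one, one_mul]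
  positivity

/-- Completeness of the sine functions: if `f` is orthogonal to all of them, `f sin x sin y` is
orthogonal to the algebra generated by `cos x` and `cos y`, hence to all test functions. -/
theorem eq_zero_of_inner_sinL2_eq_zero {f : L2} (hf : ∀ k, inner ℝ (sinL2 k) f = 0) : f = 0 := by
  have hint : Integrable (fun z => f z * sinMode (0, 0) z) (volume.restrict Omega) :=
    integrable_L2_mul (memLp_Omega_of_continuous (continuous_sinMode _))
  have key : ∀ᵐ z ∂(volume.restrict Omega), z ∈ Omega → f z * sinMode (0, 0) z = 0 := by
    refine isOpen_Omega.ae_eq_zero_of_integral_contDiff_smul_eq_zero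
      (hint.locallyIntegrable.locallyIntegrableOn _) ?_
    intro g hg _ _
    set I : ℝ := ∫ z in Omega, |f z * sinMode (0, 0) z| with hI
    have hI0 : 0 ≤ I := integral_nonneg fun z => abs_nonneg _
    have hle : ∀ ε : ℝ, 0 < ε → |∫ z in Omega, g z • (f z * sinMode (0, 0) z)| ≤ ε * I := by
      intro ε hε
      obtain ⟨h, hh, hclose⟩ := exists_sinMultiplier_near hg.continuous hε
      have h0 := integral_mul_sinSpan_eq_zero hf (hh _ (Submodule.subset_span
        (mem_range_self ((0, 0) : ℕ × ℕ))))
      have hint1 : Integrable (fun z => g z * (f z * sinMode (0, 0) z))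
          (volume.restrict Omega) := by
        have := integrable_L2_mul (f := f) (memLp_Omega_of_continuous
          (hg.continuous.mul (continuous_sinMode (0, 0))))
        refine this.congr (Eventually.of_forall fun z => ?_)
        simp only [Pi.mul_apply]
        ring
      have hint2 := integrable_L2_mul (f := f) (memLp_Omega_of_continuous h0.1)
      have heq : ∫ z in Omega, g z • (f z * sinMode (0, 0) z) =
          ∫ z in Omega, (g z - h z) * (f z * sinMode (0, 0) z) := by
        have : ∀ z, (g z - h z) * (f z * sinMode (0, 0) z) =
            g z * (f z * sinMode (0, 0) z) - f z * (⇑h * sinMode (0, 0)) z := by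
          intro z
          simp only [Pi.mul_apply]
          ring
        simp_rw [this]
        rw [integral_sub hint1 hint2, h0.2, sub_zero]
        simp
      rw [heq, hI, ← integral_const_mul]
      refine (abs_integral_le_integral_abs).trans ?_
      refine integral_mono_of_nonneg (Eventually.of_forall fun z => abs_nonneg _)
        (hint.abs.const_mul ε) ?_
      filter_upwards [ae_restrict_mem measurableSet_Omega] with z hz
      rw [abs_mul, abs_sub_comm]
      exact mul_le_mul_of_nonneg_right (hclose z hz).le (abs_nonneg _)
    refine abs_eq_zero.1 (le_antisymm (le_of_forall_pos_le_add fun δ hδ => ?_) (abs_nonneg _))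
    refine (hle (δ / (I + 1)) (by positivity)).trans ?_
    rw [zero_add, div_mul_eq_mul_div, div_le_iff₀ (by positivity)]
    nlinarith
  refine (Lp.eq_zero_iff_ae_eq_zero).2 ?_
  filter_upwards [key, ae_restrict_mem measurableSet_Omega] with z hz hmem
  exact (mul_eq_zero.1 (hz hmem)).resolve_right (sinMode_zero_pos hmem).ne'

/-- The orthonormal basis of `L²(Ω)` formed by the sine functions. -/
def sinBasis : HilbertBasis (ℕ × ℕ) ℝ L2 :=
  HilbertBasis.mkOfOrthogonalEqBot orthonormal_sinL2 <| by
    rw [Submodule.eq_bot_iff]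
    intro f hf
    refine eq_zero_of_inner_sinL2_eq_zero fun k => ?_
    exact (Submodule.mem_orthogonal _ _).1 hf _ (Submodule.subset_span (mem_range_self k))

theorem sinBasis_apply (k : ℕ × ℕ) : sinBasis k = sinL2 k := by
  rw [sinBasis, HilbertBasis.coe_mkOfOrthogonalEqBot]

/-- The sine coefficient of index `k` of a function in `L²(Ω)`, as a continuous linear form. -/
def coeff (k : ℕ × ℕ) : L2 →L[ℝ] ℝ := innerSL ℝ (sinL2 k)

theorem coeff_eq (k : ℕ × ℕ) (f : L2) : coeff k f = ∫ z in Omega, f z * sinMode k z := by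
  rw [← inner_sinL2]
  rfl

theorem coeff_eq_of_ae {k : ℕ × ℕ} {f : L2} {v : ℝ × ℝ → ℝ}
    (h : f =ᵐ[volume.restrict Omega] v) : coeff k f = ∫ z in Omega, v z * sinMode k z := by
  rw [coeff_eq]
  refine integral_congr_ae ?_
  filter_upwards [h] with z hz
  rw [hz]

theorem hasSum_coeff_smul (f : L2) : HasSum (fun k => coeff k f • sinL2 k) f := by
  have := sinBasis.hasSum_repr f
  simp only [HilbertBasis.repr_apply_apply, sinBasis_apply] at this
  exact this

theorem hasSum_coeff_mul (f g : L2) :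
    HasSum (fun k => coeff k f * coeff k g) (∫ z in Omega, f z * g z) := by
  rw [← inner_L2_eq]
  have := sinBasis.hasSum_inner_mul_inner f g
  simp only [sinBasis_apply] at this
  refine this.congr_fun fun k => ?_
  rw [real_inner_comm]
  rfl

theorem hasSum_coeff_sq (f : L2) : HasSum (fun k => coeff k f ^ 2) (‖f‖ ^ 2) := by
  have := hasSum_coeff_mul f f
  rw [← inner_L2_eq, real_inner_self_eq_norm_sq] at this
  simpa only [sq] using this

theorem coeff_sinL2 (k l : ℕ × ℕ) : coeff k (sinL2 l) = if k = l then 1 else 0 :=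
  orthonormal_iff_ite.1 orthonormal_sinL2 k l

/-! ### Integration by parts and the space `H¹₀(Ω)` -/

theorem dx_eq_fderiv {v : ℝ × ℝ → ℝ} {z : ℝ × ℝ} (hv : DifferentiableAt ℝ v z) :
    dx v z = fderiv ℝ v z (1, 0) := by
  have h1 : HasDerivAt (fun s : ℝ => (s, z.2)) ((1 : ℝ), (0 : ℝ)) z.1 :=
    (hasDerivAt_id z.1).prodMk (hasDerivAt_const z.1 z.2)
  exact (HasFDerivAt.comp_hasDerivAt (x := z.1) (f := fun s : ℝ => (s, z.2))
    hv.hasFDerivAt h1).deriv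

theorem dy_eq_fderiv {v : ℝ × ℝ → ℝ} {z : ℝ × ℝ} (hv : DifferentiableAt ℝ v z) :
    dy v z = fderiv ℝ v z (0, 1) := by
  have h1 : HasDerivAt (fun s : ℝ => (z.1, s)) ((0 : ℝ), (1 : ℝ)) z.2 :=
    (hasDerivAt_const z.2 z.1).prodMk (hasDerivAt_id z.2)
  exact (HasFDerivAt.comp_hasDerivAt (x := z.2) (f := fun s : ℝ => (z.1, s))
    hv.hasFDerivAt h1).deriv

theorem dx_eq_fderiv_fun {v : ℝ × ℝ → ℝ} (hv : ContDiff ℝ ∞ v) :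
    dx v = fun z => fderiv ℝ v z (1, 0) :=
  funext fun z => dx_eq_fderiv (hv.differentiable (by simp) z)

theorem dy_eq_fderiv_fun {v : ℝ × ℝ → ℝ} (hv : ContDiff ℝ ∞ v) :
    dy v = fun z => fderiv ℝ v z (0, 1) :=
  funext fun z => dy_eq_fderiv (hv.differentiable (by simp) z)

theorem contDiff_dx {v : ℝ × ℝ → ℝ} (hv : ContDiff ℝ ∞ v) : ContDiff ℝ ∞ (dx v) := by
  rw [dx_eq_fderiv_fun hv]
  exact (hv.fderiv_right (by simp)).clm_apply contDiff_const

theorem contDiff_dy {v : ℝ × ℝ → ℝ} (hv : ContDiff ℝ ∞ v) : ContDiff ℝ ∞ (dy v) := by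
  rw [dy_eq_fderiv_fun hv]
  exact (hv.fderiv_right (by simp)).clm_apply contDiff_const

theorem IsTest.of_tsupport_subset {v w : ℝ × ℝ → ℝ} (hv : IsTest v) (hw : ContDiff ℝ ∞ w)
    (h : tsupport w ⊆ tsupport v) : IsTest w :=
  ⟨hw, hv.2.1.of_isClosed_subset (isClosed_tsupport w) h, h.trans hv.2.2⟩

theorem IsTest.dx {v : ℝ × ℝ → ℝ} (hv : IsTest v) : IsTest (dx v) := by
  refine hv.of_tsupport_subset (contDiff_dx hv.1) ?_
  rw [dx_eq_fderiv_fun hv.1]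
  exact tsupport_fderiv_apply_subset ℝ _

theorem IsTest.dy {v : ℝ × ℝ → ℝ} (hv : IsTest v) : IsTest (dy v) := by
  refine hv.of_tsupport_subset (contDiff_dy hv.1) ?_
  rw [dy_eq_fderiv_fun hv.1]
  exact tsupport_fderiv_apply_subset ℝ _

theorem IsTest.continuous {v : ℝ × ℝ → ℝ} (hv : IsTest v) : Continuous v := hv.1.continuous

theorem IsTest.integral_mul_eq {v : ℝ × ℝ → ℝ} (hv : IsTest v) (g : ℝ × ℝ → ℝ) :
    ∫ z in Omega, v z * g z = ∫ z, v z * g z := by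
  refine setIntegral_eq_integral_of_forall_compl_eq_zero fun z hz => ?_
  rw [image_eq_zero_of_notMem_tsupport fun h => hz (hv.2.2 h), zero_mul]

theorem IsTest.integrable_mul {v g : ℝ × ℝ → ℝ} (hv : IsTest v) (hg : Continuous g) :
    Integrable (fun z => v z * g z) :=
  (hv.continuous.mul hg).integrable_of_hasCompactSupport hv.2.1.mul_right

theorem IsTest.integral_dx_mul {v g : ℝ × ℝ → ℝ} (hv : IsTest v) (hg : ContDiff ℝ ∞ g) :
    ∫ z in Omega, WaveObserver.dx v z * g z = -∫ z in Omega, v z * WaveObserver.dx g z := by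
  rw [hv.integral_mul_eq, hv.dx.integral_mul_eq]
  have h1 := hv.dx.integrable_mul hg.continuous
  have h2 := hv.integrable_mul (contDiff_dx hg).continuous
  rw [dx_eq_fderiv_fun hg, dx_eq_fderiv_fun hv.1] at *
  rw [integral_mul_fderiv_eq_neg_fderiv_mul_of_integrable h1 h2 (hv.integrable_mul hg.continuous)
    (fun x _ => hv.1.differentiable (by simp) x) (fun x _ => hg.differentiable (by simp) x),
    neg_neg]

theorem IsTest.integral_dy_mul {v g : ℝ × ℝ → ℝ} (hv : IsTest v) (hg : ContDiff ℝ ∞ g) :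
    ∫ z in Omega, WaveObserver.dy v z * g z = -∫ z in Omega, v z * WaveObserver.dy g z := by
  rw [hv.integral_mul_eq, hv.dy.integral_mul_eq]
  have h1 := hv.dy.integrable_mul hg.continuous
  have h2 := hv.integrable_mul (contDiff_dy hg).continuous
  rw [dy_eq_fderiv_fun hg, dy_eq_fderiv_fun hv.1] at *
  rw [integral_mul_fderiv_eq_neg_fderiv_mul_of_integrable h1 h2 (hv.integrable_mul hg.continuous)
    (fun x _ => hv.1.differentiable (by simp) x) (fun x _ => hg.differentiable (by simp) x),
    neg_neg]

theorem contDiff_lap {v : ℝ × ℝ → ℝ} (hv : ContDiff ℝ ∞ v) : ContDiff ℝ ∞ (lap v) :=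
  (contDiff_dx (contDiff_dx hv)).add (contDiff_dy (contDiff_dy hv))

theorem IsTest.integrableOn_mul {v g : ℝ × ℝ → ℝ} (hv : IsTest v) (hg : Continuous g) :
    Integrable (fun z => v z * g z) (volume.restrict Omega) :=
  (hv.integrable_mul hg).integrableOn

/-- Green's formula for two smooth functions, one of which has compact support in `Ω`. -/
theorem IsTest.integral_lap_mul {v g : ℝ × ℝ → ℝ} (hv : IsTest v) (hg : ContDiff ℝ ∞ g) :
    ∫ z in Omega, lap v z * g z = ∫ z in Omega, v z * lap g z := by
  simp only [lap, add_mul, mul_add]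
  rw [integral_add (hv.dx.dx.integrableOn_mul hg.continuous)
      (hv.dy.dy.integrableOn_mul hg.continuous),
    integral_add (hv.integrableOn_mul (contDiff_dx (contDiff_dx hg)).continuous)
      (hv.integrableOn_mul (contDiff_dy (contDiff_dy hg)).continuous),
    hv.dx.integral_dx_mul hg, hv.integral_dx_mul (contDiff_dx hg), hv.dy.integral_dy_mul hg,
    hv.integral_dy_mul (contDiff_dy hg), neg_neg, neg_neg]

theorem IsTest.integral_lap_mul_self {v : ℝ × ℝ → ℝ} (hv : IsTest v) :
    ∫ z in Omega, lap v z * v z = -((∫ z in Omega, WaveObserver.dx v z * WaveObserver.dx v z) +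
      ∫ z in Omega, WaveObserver.dy v z * WaveObserver.dy v z) := by
  simp only [lap, add_mul]
  rw [integral_add (hv.dx.dx.integrableOn_mul hv.continuous)
      (hv.dy.dy.integrableOn_mul hv.continuous),
    hv.dx.integral_dx_mul hv.1, hv.dy.integral_dy_mul hv.1, neg_add]

/-- The eigenvalue `p² + q²` of the Dirichlet Laplacian `-Δ` on `Ω` for `sinMode k`. -/
def eigenvalue (k : ℕ × ℕ) : ℝ := ((k.1 + 1 : ℕ) : ℝ) ^ 2 + ((k.2 + 1 : ℕ) : ℝ) ^ 2

theorem eigenvalue_pos (k : ℕ × ℕ) : 0 < eigenvalue k := by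
  unfold eigenvalue
  positivity

theorem dx_sinMode (k : ℕ × ℕ) (z : ℝ × ℝ) : dx (sinMode k) z = 2 / Real.pi *
    ((k.1 + 1 : ℕ) * Real.cos ((k.1 + 1 : ℕ) * z.1) * Real.sin ((k.2 + 1 : ℕ) * z.2)) := by
  have h : HasDerivAt (fun s => sinMode k (s, z.2)) (2 / Real.pi *
      (Real.cos ((k.1 + 1 : ℕ) * z.1) * ((k.1 + 1 : ℕ) * 1) * Real.sin ((k.2 + 1 : ℕ) * z.2)))
      z.1 := by
    simp only [sinMode]
    exact (((((hasDerivAt_id z.1).const_mul ((k.1 + 1 : ℕ) : ℝ)).sin).mul_const _).const_mul _)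
  rw [dx, h.deriv]
  ring

theorem dy_sinMode (k : ℕ × ℕ) (z : ℝ × ℝ) : dy (sinMode k) z = 2 / Real.pi *
    (Real.sin ((k.1 + 1 : ℕ) * z.1) * ((k.2 + 1 : ℕ) * Real.cos ((k.2 + 1 : ℕ) * z.2))) := by
  have h : HasDerivAt (fun s => sinMode k (z.1, s)) (2 / Real.pi *
      (Real.sin ((k.1 + 1 : ℕ) * z.1) * (Real.cos ((k.2 + 1 : ℕ) * z.2) * ((k.2 + 1 : ℕ) * 1))))
      z.2 := by
    simp only [sinMode]
    exact (((((hasDerivAt_id z.2).const_mul ((k.2 + 1 : ℕ) : ℝ)).sin).const_mul _).const_mul _)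
  rw [dy, h.deriv]
  ring

theorem lap_sinMode (k : ℕ × ℕ) (z : ℝ × ℝ) :
    lap (sinMode k) z = -eigenvalue k * sinMode k z := by
  have h1 : HasDerivAt (fun s => dx (sinMode k) (s, z.2)) (2 / Real.pi *
      ((k.1 + 1 : ℕ) * (-Real.sin ((k.1 + 1 : ℕ) * z.1) * ((k.1 + 1 : ℕ) * 1)) *
        Real.sin ((k.2 + 1 : ℕ) * z.2))) z.1 := by
    simp only [dx_sinMode]
    exact ((((((hasDerivAt_id z.1).const_mul ((k.1 + 1 : ℕ) : ℝ)).cos).const_mul _).mul_const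
      _).const_mul _)
  have h2 : HasDerivAt (fun s => dy (sinMode k) (z.1, s)) (2 / Real.pi *
      (Real.sin ((k.1 + 1 : ℕ) * z.1) *
        ((k.2 + 1 : ℕ) * (-Real.sin ((k.2 + 1 : ℕ) * z.2) * ((k.2 + 1 : ℕ) * 1))))) z.2 := by
    simp only [dy_sinMode]
    exact ((((((hasDerivAt_id z.2).const_mul ((k.2 + 1 : ℕ) : ℝ)).cos).const_mul _).const_mul
      _).const_mul _)
  rw [lap, dx, dy, h1.deriv, h2.deriv, eigenvalue, sinMode]
  ring

theorem IsTest.integral_lap_mul_sinMode {v : ℝ × ℝ → ℝ} (hv : IsTest v) (k : ℕ × ℕ) :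
    ∫ z in Omega, lap v z * sinMode k z = -eigenvalue k * ∫ z in Omega, v z * sinMode k z := by
  rw [hv.integral_lap_mul (contDiff_sinMode k), ← integral_const_mul]
  refine integral_congr_ae (Eventually.of_forall fun z => ?_)
  simp only [lap_sinMode]
  ring

theorem IsTest.memLp_lap {v : ℝ × ℝ → ℝ} (hv : IsTest v) :
    MemLp (lap v) 2 (volume.restrict Omega) :=
  memLp_Omega_of_continuous (contDiff_lap hv.1).continuous

theorem IsTest.coeff_lap {v : ℝ × ℝ → ℝ} (hv : IsTest v) {f : L2}
    (hf : f =ᵐ[volume.restrict Omega] v) (k : ℕ × ℕ) :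
    coeff k (hv.memLp_lap.toLp (lap v)) = -eigenvalue k * coeff k f := by
  rw [coeff_eq_of_ae hv.memLp_lap.coeFn_toLp, hv.integral_lap_mul_sinMode, coeff_eq_of_ae hf]

/-- `U` is the triple `(v, ∂v/∂x, ∂v/∂y)` in `L²(Ω)³`. -/
def Represents (U : L2 × L2 × L2) (v : ℝ × ℝ → ℝ) : Prop :=
  U.1 =ᵐ[volume.restrict Omega] v ∧ U.2.1 =ᵐ[volume.restrict Omega] dx v ∧
    U.2.2 =ᵐ[volume.restrict Omega] dy v

theorem mem_H10_of_isTest {U : L2 × L2 × L2} {v : ℝ × ℝ → ℝ} (hv : IsTest v)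
    (hU : Represents U v) : U ∈ H10 := subset_closure ⟨v, hv, hU⟩

theorem Represents.sub {U V : L2 × L2 × L2} {u v : ℝ × ℝ → ℝ} (hU : Represents U u)
    (hV : Represents V v) (hu : IsTest u) (hv : IsTest v) : Represents (U - V) (u - v) := by
  have hd : ∀ {w : ℝ × ℝ → ℝ}, IsTest w → ∀ z, DifferentiableAt ℝ w z :=
    fun hw z => hw.1.differentiable (by simp) z
  refine ⟨(Lp.coeFn_sub _ _).trans (hU.1.sub hV.1), (Lp.coeFn_sub _ _).trans ?_,
    (Lp.coeFn_sub _ _).trans ?_⟩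
  · filter_upwards [hU.2.1, hV.2.1] with z h1 h2
    rw [Pi.sub_apply, h1, h2, dx_eq_fderiv (hd hu z), dx_eq_fderiv (hd hv z),
      dx_eq_fderiv ((hd hu z).sub (hd hv z)), fderiv_sub (hd hu z) (hd hv z)]
    rfl
  · filter_upwards [hU.2.2, hV.2.2] with z h1 h2
    rw [Pi.sub_apply, h1, h2, dy_eq_fderiv (hd hu z), dy_eq_fderiv (hd hv z),
      dy_eq_fderiv ((hd hu z).sub (hd hv z)), fderiv_sub (hd hu z) (hd hv z)]
    rfl

theorem sub_mem_H10 {U V : L2 × L2 × L2} (hU : U ∈ H10) (hV : V ∈ H10) : U - V ∈ H10 := by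
  refine map_mem_closure₂ continuous_sub hU hV ?_
  rintro a ⟨u, hu, hau⟩ b ⟨v, hv, hbv⟩
  refine ⟨u - v, ⟨hu.1.sub hv.1, ?_, ?_⟩, Represents.sub hau hbv hu hv⟩
  · exact hu.2.1.sub hv.2.1
  · exact (tsupport_sub u v).trans (union_subset hu.2.2 hv.2.2)

/-- The squared norm `∫_Ω |∇u|²` of the gradient part of a triple. -/
def gradSq (U : L2 × L2 × L2) : ℝ := ‖U.2.1‖ ^ 2 + ‖U.2.2‖ ^ 2

theorem continuous_gradSq : Continuous gradSq := by
  unfold gradSq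
  fun_prop

theorem gradSq_nonneg (U : L2 × L2 × L2) : 0 ≤ gradSq U := by
  unfold gradSq
  positivity

theorem norm_sq_eq_integral (f : L2) : ‖f‖ ^ 2 = ∫ z in Omega, f z * f z := by
  rw [← inner_L2_eq, real_inner_self_eq_norm_sq]

theorem norm_sq_eq_integral_of_ae {f : L2} {v : ℝ × ℝ → ℝ} (h : f =ᵐ[volume.restrict Omega] v) :
    ‖f‖ ^ 2 = ∫ z in Omega, v z * v z := by
  rw [norm_sq_eq_integral]
  refine integral_congr_ae ?_
  filter_upwards [h] with z hz
  rw [hz]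

theorem IsTest.hasSum_gradSq {v : ℝ × ℝ → ℝ} (hv : IsTest v) {U : L2 × L2 × L2}
    (hU : Represents U v) : HasSum (fun k => eigenvalue k * coeff k U.1 ^ 2) (gradSq U) := by
  have h1 : gradSq U = -∫ z in Omega, (hv.memLp_lap.toLp (lap v)) z * U.1 z := by
    have h2 : ∫ z in Omega, (hv.memLp_lap.toLp (lap v)) z * U.1 z =
        ∫ z in Omega, lap v z * v z := by
      refine integral_congr_ae ?_
      filter_upwards [hv.memLp_lap.coeFn_toLp, hU.1] with z hz1 hz2
      rw [hz1, hz2]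
    rw [h2, hv.integral_lap_mul_self, neg_neg, gradSq, norm_sq_eq_integral_of_ae hU.2.1,
      norm_sq_eq_integral_of_ae hU.2.2]
  rw [h1]
  refine (hasSum_coeff_mul (hv.memLp_lap.toLp (lap v)) U.1).neg.congr_fun fun k => ?_
  rw [hv.coeff_lap hU.1]
  ring

/-- A finite partial sum is continuous in `U`, so that the bound, which holds on test functions,
passes to their closure. -/
theorem sum_eigenvalue_mul_sq_le {U : L2 × L2 × L2} (hU : U ∈ H10) (F : Finset (ℕ × ℕ)) :
    ∑ k ∈ F, eigenvalue k * coeff k U.1 ^ 2 ≤ gradSq U := by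
  have hcl : IsClosed {U : L2 × L2 × L2 | ∑ k ∈ F, eigenvalue k * coeff k U.1 ^ 2 ≤ gradSq U} := by
    refine isClosed_le ?_ continuous_gradSq
    refine continuous_finsetSum _ fun k _ => continuous_const.mul
      (((coeff k).continuous.comp continuous_fst).pow 2)
  refine closure_minimal ?_ hcl hU
  rintro V ⟨v, hv, hV⟩
  exact sum_le_hasSum _ (fun k _ => mul_nonneg (eigenvalue_pos k).le (sq_nonneg _))
    (hv.hasSum_gradSq hV)

theorem summable_eigenvalue_mul_sq {U : L2 × L2 × L2} (hU : U ∈ H10) :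
    Summable (fun k => eigenvalue k * coeff k U.1 ^ 2) :=
  summable_of_sum_le (fun k => mul_nonneg (eigenvalue_pos k).le (sq_nonneg _))
    (sum_eigenvalue_mul_sq_le hU)

theorem tsum_eigenvalue_mul_sq_le {U : L2 × L2 × L2} (hU : U ∈ H10) :
    ∑' k, eigenvalue k * coeff k U.1 ^ 2 ≤ gradSq U :=
  (summable_eigenvalue_mul_sq hU).tsum_le_of_sum_le (sum_eigenvalue_mul_sq_le hU)

/-- The gradient norm is controlled by the sine coefficients. The constant `2` (in place of `1`)
comes from passing to the limit with `(a + b)² ≤ 2a² + 2b²`. -/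
theorem gradSq_le_two_mul_tsum {U : L2 × L2 × L2} (hU : U ∈ H10) :
    gradSq U ≤ 2 * ∑' k, eigenvalue k * coeff k U.1 ^ 2 := by
  obtain ⟨V, hV, hlim⟩ := mem_closure_iff_seq_limit.1 hU
  have hle : ∀ n, gradSq (V n) ≤
      2 * ∑' k, eigenvalue k * coeff k U.1 ^ 2 + 2 * gradSq (V n - U) := by
    intro n
    obtain ⟨v, hv, hVv⟩ := hV n
    have hmem : V n - U ∈ H10 := sub_mem_H10 (mem_H10_of_isTest hv hVv) hU
    have h1 := ((summable_eigenvalue_mul_sq hU).hasSum.mul_left 2).add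
      ((summable_eigenvalue_mul_sq hmem).hasSum.mul_left 2)
    refine (hasSum_le (fun k => ?_) (hv.hasSum_gradSq hVv) h1).trans ?_
    · have h2 : coeff k (V n - U).1 = coeff k (V n).1 - coeff k U.1 := by
        rw [Prod.fst_sub, map_sub]
      rw [h2]
      have := mul_nonneg (eigenvalue_pos k).le (sq_nonneg (coeff k (V n).1 - 2 * coeff k U.1))
      linarith
    · linarith [tsum_eigenvalue_mul_sq_le hmem]
  have h1 : Tendsto (fun n => gradSq (V n)) atTop (𝓝 (gradSq U)) :=
    (continuous_gradSq.tendsto U).comp hlim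
  have h2 : Tendsto (fun n => gradSq (V n - U)) atTop (𝓝 0) := by
    have h3 : Tendsto (fun n => V n - U) atTop (𝓝 (U - U)) := hlim.sub_const U
    have h4 := (continuous_gradSq.tendsto (U - U)).comp h3
    have h5 : gradSq (U - U) = 0 := by simp [gradSq]
    rwa [h5] at h4
  have h3 := (h2.const_mul 2).const_add (2 * ∑' k, eigenvalue k * coeff k U.1 ^ 2)
  rw [mul_zero, add_zero] at h3
  exact le_of_tendsto_of_tendsto' h1 h3 hle

/-! ### The sine functions belong to `H¹₀(Ω)` -/

theorem tendsto_toLp_of_bounded {f : ℕ → ℝ × ℝ → ℝ} {g : ℝ × ℝ → ℝ} (hf : ∀ n, Continuous (f n))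
    (hg : Continuous g) {C : ℝ} (hC : ∀ n, ∀ z ∈ Omega, |f n z| ≤ C)
    (hlim : ∀ z ∈ Omega, Tendsto (fun n => f n z) atTop (𝓝 (g z))) :
    Tendsto (fun n => (memLp_Omega_of_continuous (hf n)).toLp (f n)) atTop
      (𝓝 ((memLp_Omega_of_continuous hg).toLp g)) := by
  have hgC : ∀ z ∈ Omega, |g z| ≤ C := fun z hz =>
    le_of_tendsto' (hlim z hz).abs fun n => hC n z hz
  have hsq : ∀ n, ‖(memLp_Omega_of_continuous (hf n)).toLp (f n) -
      (memLp_Omega_of_continuous hg).toLp g‖ ^ 2 =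
      ∫ z in Omega, (f n - g) z * (f n - g) z := by
    intro n
    rw [← MemLp.toLp_sub]
    exact norm_sq_eq_integral_of_ae (MemLp.coeFn_toLp _)
  have hint : Tendsto (fun n => ∫ z in Omega, (f n - g) z * (f n - g) z) atTop
      (𝓝 (∫ _ in Omega, (0 : ℝ))) := by
    refine tendsto_integral_of_dominated_convergence (fun _ => (2 * C) * (2 * C))
      (fun n => (((hf n).sub hg).mul ((hf n).sub hg)).aestronglyMeasurable)
      (integrable_const _) (fun n => ?_) ?_
    · filter_upwards [ae_restrict_mem measurableSet_Omega] with z hz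
      have h1 : |(f n - g) z| ≤ 2 * C := by
        rw [Pi.sub_apply]
        linarith [abs_sub (f n z) (g z), hC n z hz, hgC z hz]
      rw [Real.norm_eq_abs, abs_mul]
      exact mul_le_mul h1 h1 (abs_nonneg _) ((abs_nonneg _).trans h1)
    · filter_upwards [ae_restrict_mem measurableSet_Omega] with z hz
      have h1 : Tendsto (fun n => f n z - g z) atTop (𝓝 0) := by
        simpa using (hlim z hz).sub_const (g z)
      simpa using h1.mul h1
  rw [tendsto_iff_norm_sub_tendsto_zero]
  have h1 : Tendsto (fun n => Real.sqrt (∫ z in Omega, (f n - g) z * (f n - g) z)) atTop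
      (𝓝 (Real.sqrt 0)) := by
    refine (Real.continuous_sqrt.tendsto 0).comp ?_
    simpa using hint
  rw [Real.sqrt_zero] at h1
  refine h1.congr fun n => ?_
  rw [← hsq, Real.sqrt_sq (norm_nonneg _)]

/-- The triple `(v, ∂v/∂x, ∂v/∂y)` of a smooth function on the plane, as an element of
`L²(Ω)³`. -/
def smoothTriple (v : ℝ × ℝ → ℝ) (hv : ContDiff ℝ ∞ v) : L2 × L2 × L2 :=
  ((memLp_Omega_of_continuous hv.continuous).toLp v,
    (memLp_Omega_of_continuous (contDiff_dx hv).continuous).toLp (dx v),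
    (memLp_Omega_of_continuous (contDiff_dy hv).continuous).toLp (dy v))

theorem represents_smoothTriple {v : ℝ × ℝ → ℝ} (hv : ContDiff ℝ ∞ v) :
    Represents (smoothTriple v hv) v :=
  ⟨(memLp_Omega_of_continuous hv.continuous).coeFn_toLp,
    (memLp_Omega_of_continuous (contDiff_dx hv).continuous).coeFn_toLp,
    (memLp_Omega_of_continuous (contDiff_dy hv).continuous).coeFn_toLp⟩

theorem smoothTriple_mem_H10_of_tendsto {v : ℝ × ℝ → ℝ} (hv : ContDiff ℝ ∞ v)
    {f : ℕ → ℝ × ℝ → ℝ} (hf : ∀ n, IsTest (f n)) {C : ℝ}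
    (hC : ∀ n, ∀ z ∈ Omega, |f n z| ≤ C ∧ |dx (f n) z| ≤ C ∧ |dy (f n) z| ≤ C)
    (hlim : ∀ z ∈ Omega, Tendsto (fun n => f n z) atTop (𝓝 (v z)) ∧
      Tendsto (fun n => dx (f n) z) atTop (𝓝 (dx v z)) ∧
      Tendsto (fun n => dy (f n) z) atTop (𝓝 (dy v z))) :
    smoothTriple v hv ∈ H10 := by
  refine mem_closure_of_tendsto (f := fun n => smoothTriple (f n) (hf n).1) (b := atTop) ?_
    (Eventually.of_forall fun n => ⟨f n, hf n, represents_smoothTriple _⟩)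
  refine Tendsto.prodMk_nhds ?_ (Tendsto.prodMk_nhds ?_ ?_)
  · exact tendsto_toLp_of_bounded (fun n => (hf n).continuous) hv.continuous
      (fun n z hz => (hC n z hz).1) fun z hz => (hlim z hz).1
  · exact tendsto_toLp_of_bounded (fun n => (hf n).dx.continuous) (contDiff_dx hv).continuous
      (fun n z hz => (hC n z hz).2.1) fun z hz => (hlim z hz).2.1
  · exact tendsto_toLp_of_bounded (fun n => (hf n).dy.continuous) (contDiff_dy hv).continuous
      (fun n z hz => (hC n z hz).2.2) fun z hz => (hlim z hz).2.2

/-- A smooth step: `0` on `(-∞, 1]` and `1` on `[2, ∞)`. -/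
def step (s : ℝ) : ℝ := Real.smoothTransition (s - 1)

theorem contDiff_step : ContDiff ℝ ∞ step :=
  Real.smoothTransition.contDiff.comp (contDiff_id.sub contDiff_const)

theorem step_eq_zero {s : ℝ} (hs : s ≤ 1) : step s = 0 :=
  Real.smoothTransition.zero_of_nonpos (by linarith)

theorem step_eq_one {s : ℝ} (hs : 2 ≤ s) : step s = 1 :=
  Real.smoothTransition.one_of_one_le (by linarith)

theorem abs_step_le (s : ℝ) : |step s| ≤ 1 := by
  rw [step, abs_of_nonneg (Real.smoothTransition.nonneg _)]
  exact Real.smoothTransition.le_one _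

theorem deriv_step_eq_zero_of_lt {s : ℝ} (hs : s < 1) : deriv step s = 0 := by
  have : step =ᶠ[𝓝 s] fun _ => 0 := by
    filter_upwards [Iio_mem_nhds hs] with x hx using step_eq_zero (le_of_lt hx)
  rw [this.deriv_eq, deriv_const]

theorem deriv_step_eq_zero_of_gt {s : ℝ} (hs : 2 < s) : deriv step s = 0 := by
  have : step =ᶠ[𝓝 s] fun _ => 1 := by
    filter_upwards [Ioi_mem_nhds hs] with x hx using step_eq_one (le_of_lt hx)
  rw [this.deriv_eq, deriv_const]

theorem exists_abs_deriv_step_mul_le : ∃ M : ℝ, 0 ≤ M ∧ ∀ s, |deriv step s| * |s| ≤ M := by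
  have hcont : Continuous fun s => deriv step s * s :=
    (contDiff_step.continuous_deriv (by simp)).mul continuous_id
  obtain ⟨M, hM⟩ := (isCompact_Icc (a := (1 : ℝ)) (b := 2)).exists_bound_of_continuousOn
    hcont.continuousOn
  have hM0 : 0 ≤ M := (norm_nonneg _).trans (hM 1 (by norm_num))
  refine ⟨M, hM0, fun s => ?_⟩
  by_cases h1 : s < 1
  · simp [deriv_step_eq_zero_of_lt h1, hM0]
  by_cases h2 : 2 < s
  · simp [deriv_step_eq_zero_of_gt h2, hM0]
  rw [← abs_mul]
  exact hM s ⟨not_lt.1 h1, not_lt.1 h2⟩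

/-- The function `sin(px)` cut off at distance `1 / (n + 1)` from the end points of `(0, π)`. -/
def cutSin (p n : ℕ) (x : ℝ) : ℝ :=
  step ((n + 1) * x) * step ((n + 1) * (Real.pi - x)) * Real.sin (p * x)

theorem contDiff_cutSin (p n : ℕ) : ContDiff ℝ ∞ (cutSin p n) := by
  have := contDiff_step
  unfold cutSin
  fun_prop

theorem abs_cutSin_le (p n : ℕ) (x : ℝ) : |cutSin p n x| ≤ 1 := by
  rw [cutSin, abs_mul, abs_mul]
  have h1 := mul_le_mul (abs_step_le ((n + 1) * x)) (abs_step_le ((n + 1) * (Real.pi - x)))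
    (abs_nonneg _) zero_le_one
  have h2 := mul_le_mul h1 (Real.abs_sin_le_one (p * x)) (abs_nonneg _) (by norm_num)
  simpa using h2

theorem deriv_cutSin (p n : ℕ) (x : ℝ) : deriv (cutSin p n) x =
    (deriv step ((n + 1) * x) * (n + 1)) * step ((n + 1) * (Real.pi - x)) * Real.sin (p * x)
    - step ((n + 1) * x) * (deriv step ((n + 1) * (Real.pi - x)) * (n + 1)) * Real.sin (p * x)
    + step ((n + 1) * x) * step ((n + 1) * (Real.pi - x)) * (p * Real.cos (p * x)) := by
  have hs : ∀ s, HasDerivAt step (deriv step s) s := fun s =>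
    (contDiff_step.differentiable (by simp) s).hasDerivAt
  have h1 : HasDerivAt (fun x : ℝ => ((n : ℝ) + 1) * x) (((n : ℝ) + 1) * 1) x :=
    (hasDerivAt_id x).const_mul _
  have h2 : HasDerivAt (fun x : ℝ => ((n : ℝ) + 1) * (Real.pi - x)) (((n : ℝ) + 1) * (-1)) x :=
    ((hasDerivAt_id x).const_sub Real.pi).const_mul _
  have h3 : HasDerivAt (fun x : ℝ => (p : ℝ) * x) ((p : ℝ) * 1) x :=
    (hasDerivAt_id x).const_mul _
  have h4 : HasDerivAt (cutSin p n) _ x :=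
    ((((hs _).comp x h1).mul ((hs _).comp x h2)).mul h3.sin)
  rw [h4.deriv]
  simp only [Pi.mul_apply, Function.comp_apply]
  ring

theorem abs_sin_nat_mul_le (p : ℕ) (x : ℝ) : |Real.sin (p * x)| ≤ p * |x| := by
  refine (Real.abs_sin_le_abs).trans ?_
  rw [abs_mul, Nat.abs_cast]

theorem abs_sin_nat_mul_le' (p : ℕ) (x : ℝ) : |Real.sin (p * x)| ≤ p * |Real.pi - x| := by
  have h1 : Real.sin (p * x) = -((-1) ^ p * Real.sin (p * (Real.pi - x))) := by
    rw [mul_sub, Real.sin_nat_mul_pi_sub]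
    have : ((-1 : ℝ) ^ p) * (-1) ^ p = 1 := by rw [← mul_pow]; simp
    linear_combination (-Real.sin (p * x)) * this
  rw [h1, abs_neg, abs_mul, abs_pow, abs_neg, abs_one, one_pow, one_mul]
  exact abs_sin_nat_mul_le p _

/-- The derivatives of the cut-off sines are bounded uniformly in `n`: where the derivative of the
cut-off is of size `n + 1`, the sine is of size `1 / (n + 1)`. -/
theorem exists_abs_deriv_cutSin_le (p : ℕ) : ∃ C : ℝ, ∀ n x, |deriv (cutSin p n) x| ≤ C := by
  obtain ⟨M, hM0, hM⟩ := exists_abs_deriv_step_mul_le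
  refine ⟨M * p + M * p + p, fun n x => ?_⟩
  have hn : (0 : ℝ) < (n : ℝ) + 1 := by positivity
  have hbound : ∀ s y r : ℝ, |r| ≤ 1 → |s| ≤ p * |y| →
      |deriv step ((n + 1) * y) * (n + 1) * r * s| ≤ M * p := by
    intro s y r hr hs
    have h1 := hM ((n + 1) * y)
    rw [abs_mul ((n : ℝ) + 1), abs_of_pos hn] at h1
    rw [abs_mul, abs_mul, abs_mul, abs_of_pos hn]
    calc |deriv step ((n + 1) * y)| * (n + 1) * |r| * |s|
        ≤ |deriv step ((n + 1) * y)| * (n + 1) * 1 * (p * |y|) := by gcongr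
      _ = (|deriv step ((n + 1) * y)| * ((n + 1) * |y|)) * p := by ring
      _ ≤ M * p := by gcongr
  rw [deriv_cutSin]
  have h1 := hbound (Real.sin (p * x)) x (step ((n + 1) * (Real.pi - x))) (abs_step_le _)
    (abs_sin_nat_mul_le p x)
  have h2 := hbound (Real.sin (p * x)) (Real.pi - x) (step ((n + 1) * x)) (abs_step_le _)
    (abs_sin_nat_mul_le' p x)
  have h3 : |step ((n + 1) * x) * step ((n + 1) * (Real.pi - x)) * (p * Real.cos (p * x))| ≤ p := by
    rw [abs_mul, abs_mul, abs_mul, Nat.abs_cast]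
    calc _ ≤ (1 : ℝ) * 1 * (p * 1) := by
          gcongr
          · exact abs_step_le _
          · exact abs_step_le _
          · exact Real.abs_cos_le_one _
      _ = p := by ring
  have h4 : step ((n + 1) * x) * (deriv step ((n + 1) * (Real.pi - x)) * (n + 1)) *
      Real.sin (p * x) = deriv step ((n + 1) * (Real.pi - x)) * (n + 1) * step ((n + 1) * x) *
      Real.sin (p * x) := by ring
  rw [h4]
  refine (abs_add_le _ _).trans (add_le_add ((abs_sub _ _).trans (add_le_add h1 h2)) h3)

theorem eventually_two_lt_mul {y : ℝ} (hy : 0 < y) : ∀ᶠ n : ℕ in atTop, 2 < ((n : ℝ) + 1) * y := by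
  have h1 : Tendsto (fun n : ℕ => ((n : ℝ) + 1) * y) atTop atTop :=
    (tendsto_atTop_add_const_right _ 1 tendsto_natCast_atTop_atTop).atTop_mul_const hy
  exact h1.eventually_gt_atTop 2

theorem eventually_cutSin_eq (p : ℕ) {x : ℝ} (hx : x ∈ Ioo 0 Real.pi) :
    ∀ᶠ n in atTop, cutSin p n x = Real.sin (p * x) ∧
      deriv (cutSin p n) x = p * Real.cos (p * x) := by
  filter_upwards [eventually_two_lt_mul hx.1, eventually_two_lt_mul (sub_pos.2 hx.2)] with n h1 h2
  rw [deriv_cutSin, cutSin, step_eq_one h1.le, step_eq_one h2.le, deriv_step_eq_zero_of_gt h1,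
    deriv_step_eq_zero_of_gt h2]
  simp

/-- The test functions which approximate `sinMode k` in the `H¹` norm. -/
def cutMode (k : ℕ × ℕ) (n : ℕ) (z : ℝ × ℝ) : ℝ :=
  2 / Real.pi * (cutSin (k.1 + 1) n z.1 * cutSin (k.2 + 1) n z.2)

theorem mem_Icc_of_cutSin_ne_zero {p n : ℕ} {x : ℝ} (h : cutSin p n x ≠ 0) :
    x ∈ Icc (1 / ((n : ℝ) + 1)) (Real.pi - 1 / ((n : ℝ) + 1)) := by
  have hn : (0 : ℝ) < (n : ℝ) + 1 := by positivity
  constructor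
  · by_contra! hlt
    rw [lt_div_iff₀ hn, mul_comm] at hlt
    exact h (by rw [cutSin, step_eq_zero hlt.le]; ring)
  · by_contra! hlt
    have : Real.pi - x < 1 / ((n : ℝ) + 1) := by linarith
    rw [lt_div_iff₀ hn, mul_comm] at this
    exact h (by rw [cutSin, step_eq_zero this.le]; ring)

theorem isTest_cutMode (k : ℕ × ℕ) (n : ℕ) : IsTest (cutMode k n) := by
  set J := Icc (1 / ((n : ℝ) + 1)) (Real.pi - 1 / ((n : ℝ) + 1)) with hJ
  have hn : (0 : ℝ) < 1 / ((n : ℝ) + 1) := by positivity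
  have hsub : tsupport (cutMode k n) ⊆ J ×ˢ J := by
    refine closure_minimal (fun z hz => ?_) (isClosed_Icc.prod isClosed_Icc)
    rw [Function.mem_support, cutMode] at hz
    have h1 := right_ne_zero_of_mul hz
    exact ⟨mem_Icc_of_cutSin_ne_zero (left_ne_zero_of_mul h1),
      mem_Icc_of_cutSin_ne_zero (right_ne_zero_of_mul h1)⟩
  refine ⟨?_, ?_, hsub.trans (prod_mono ?_ ?_)⟩
  · have h1 := contDiff_cutSin (k.1 + 1) n
    have h2 := contDiff_cutSin (k.2 + 1) n
    unfold cutMode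
    fun_prop
  · exact (isCompact_Icc.prod isCompact_Icc).of_isClosed_subset (isClosed_tsupport _) hsub
  · exact fun x hx => ⟨hn.trans_le hx.1, hx.2.trans_lt (by linarith)⟩
  · exact fun x hx => ⟨hn.trans_le hx.1, hx.2.trans_lt (by linarith)⟩

theorem hasDerivAt_cutSin (p n : ℕ) (x : ℝ) : HasDerivAt (cutSin p n) (deriv (cutSin p n) x) x :=
  ((contDiff_cutSin p n).differentiable (by simp) x).hasDerivAt

theorem dx_cutMode (k : ℕ × ℕ) (n : ℕ) (z : ℝ × ℝ) : dx (cutMode k n) z =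
    2 / Real.pi * (deriv (cutSin (k.1 + 1) n) z.1 * cutSin (k.2 + 1) n z.2) := by
  simp only [dx, cutMode]
  exact (((hasDerivAt_cutSin (k.1 + 1) n z.1).mul_const _).const_mul _).deriv

theorem dy_cutMode (k : ℕ × ℕ) (n : ℕ) (z : ℝ × ℝ) : dy (cutMode k n) z =
    2 / Real.pi * (cutSin (k.1 + 1) n z.1 * deriv (cutSin (k.2 + 1) n) z.2) := by
  simp only [dy, cutMode]
  exact (((hasDerivAt_cutSin (k.2 + 1) n z.2).const_mul _).const_mul _).deriv

theorem smoothTriple_sinMode_mem_H10 (k : ℕ × ℕ) :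
    smoothTriple (sinMode k) (contDiff_sinMode k) ∈ H10 := by
  obtain ⟨C₁, h1⟩ := exists_abs_deriv_cutSin_le (k.1 + 1)
  obtain ⟨C₂, h2⟩ := exists_abs_deriv_cutSin_le (k.2 + 1)
  have hC₁ : 0 ≤ C₁ := (abs_nonneg _).trans (h1 0 0)
  have hC₂ : 0 ≤ C₂ := (abs_nonneg _).trans (h2 0 0)
  have hbound : ∀ {a b A B : ℝ}, |a| ≤ A → |b| ≤ B → A * B ≤ 1 + C₁ + C₂ →
      |2 / Real.pi * (a * b)| ≤ 2 / Real.pi * (1 + C₁ + C₂) := by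
    intro a b A B ha hb hAB
    rw [abs_mul, abs_mul, abs_of_pos (by positivity : 0 < 2 / Real.pi)]
    have := mul_le_mul ha hb (abs_nonneg b) ((abs_nonneg a).trans ha)
    gcongr
    exact this.trans hAB
  refine smoothTriple_mem_H10_of_tendsto _ (isTest_cutMode k) (C := 2 / Real.pi * (1 + C₁ + C₂))
    (fun n z _ => ⟨?_, ?_, ?_⟩) (fun z hz => ⟨?_, ?_, ?_⟩)
  · exact hbound (abs_cutSin_le _ _ _) (abs_cutSin_le _ _ _) (by linarith)
  · rw [dx_cutMode]
    exact hbound (h1 n z.1) (abs_cutSin_le _ _ _) (by linarith)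
  · rw [dy_cutMode]
    exact hbound (abs_cutSin_le _ _ _) (h2 n z.2) (by linarith)
  all_goals
    refine tendsto_const_nhds.congr' ?_
    filter_upwards [eventually_cutSin_eq (k.1 + 1) hz.1, eventually_cutSin_eq (k.2 + 1) hz.2]
      with n h3 h4
    simp only [cutMode, dx_cutMode, dy_cutMode, h3.1, h3.2, h4.1, h4.2, sinMode, dx_sinMode,
      dy_sinMode]

/-! ### Convolution with the odd periodic extension -/

theorem fold_periodic : Function.Periodic fold (2 * Real.pi) := toIcoMod_periodic _ _

theorem fold_eq_self {x : ℝ} (hx : x ∈ Ioo (-Real.pi) Real.pi) : fold x = x := by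
  refine (toIcoMod_eq_self _).2 ⟨hx.1.le, ?_⟩
  linarith [hx.2]

theorem measurable_fold : Measurable fold := by
  have : fold = fun x => -Real.pi + Int.fract ((x - -Real.pi) / (2 * Real.pi)) * (2 * Real.pi) :=
    funext fun x => toIcoMod_eq_add_fract_mul _ _ _
  rw [this]
  fun_prop

theorem measurable_sign : Measurable Real.sign := by
  unfold Real.sign
  exact Measurable.ite measurableSet_Iio measurable_const
    (Measurable.ite measurableSet_Ioi measurable_const measurable_const)

theorem abs_sign_le_one (x : ℝ) : |Real.sign x| ≤ 1 := by
  rcases Real.sign_apply_eq x with h | h | h <;> simp [h]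

theorem measurable_oddExt {u : ℝ × ℝ → ℝ} (hu : Measurable u) : Measurable (oddExt u) := by
  have h1 : Measurable fun z : ℝ × ℝ => fold z.1 := measurable_fold.comp measurable_fst
  have h2 : Measurable fun z : ℝ × ℝ => fold z.2 := measurable_fold.comp measurable_snd
  exact ((measurable_sign.comp h1).mul (measurable_sign.comp h2)).mul
    (hu.comp ((measurable_abs.comp h1).prodMk (measurable_abs.comp h2)))

theorem lintegral_Ioc_comp_sub {G : ℝ → ENNReal} (hG : Function.Periodic G (2 * Real.pi))
    (ξ t : ℝ) :
    ∫⁻ x in Ioc 0 (0 + 2 * Real.pi), G (x - ξ) = ∫⁻ x in Ioc t (t + 2 * Real.pi), G x := by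
  have hpre : (fun x : ℝ => x - ξ) ⁻¹' Ioc (-ξ) (-ξ + 2 * Real.pi) = Ioc 0 (0 + 2 * Real.pi) := by
    ext x
    simp only [mem_preimage, mem_Ioc]
    constructor <;> rintro ⟨h1, h2⟩ <;> constructor <;> linarith
  rw [← hpre, (measurePreserving_sub_right volume ξ).setLIntegral_comp_preimage_emb
    (MeasurableEquiv.subRight ξ).measurableEmbedding]
  have : VAddInvariantMeasure (AddSubgroup.zmultiples (2 * Real.pi)) ℝ volume :=
    ⟨fun c s _ => measure_preimage_add _ _ _⟩
  exact (isAddFundamentalDomain_Ioc Real.two_pi_pos (-ξ)).setLIntegral_eq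
    (isAddFundamentalDomain_Ioc Real.two_pi_pos t) G hG.map_vadd_zmultiples

/-- A translate of `(0, π)` lies in a period of `G ∘ |fold|`, whose integral over a period is twice
that of `G` over `(0, π)`. -/
theorem lintegral_fold_sub_le (G : ℝ → ENNReal) (ξ : ℝ) :
    ∫⁻ x in Ioo 0 Real.pi, G |fold (x - ξ)| ≤ 2 * ∫⁻ x in Ioo 0 Real.pi, G x := by
  have hper : Function.Periodic (fun x => G |fold x|) (2 * Real.pi) := fun x => by
    simp only [fold_periodic x]
  have hsub : Ioo 0 Real.pi ⊆ Ioc 0 (0 + 2 * Real.pi) := fun x hx =>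
    ⟨hx.1, by linarith [hx.2, Real.pi_pos]⟩
  have hneg : ∫⁻ x in Ioo (-Real.pi) 0, G |x| = ∫⁻ x in Ioo 0 Real.pi, G x := by
    have hpre : (fun x : ℝ => -x) ⁻¹' Ioo (-Real.pi) 0 = Ioo 0 Real.pi := by simp
    rw [← (Measure.measurePreserving_neg (volume : Measure ℝ)).setLIntegral_comp_preimage_emb
      (MeasurableEquiv.neg ℝ).measurableEmbedding, hpre]
    refine setLIntegral_congr_fun measurableSet_Ioo fun x hx => ?_
    simp only [abs_neg, abs_of_pos hx.1]
  have hpos : ∫⁻ x in Ioo 0 Real.pi, G |x| = ∫⁻ x in Ioo 0 Real.pi, G x :=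
    setLIntegral_congr_fun measurableSet_Ioo fun x hx => by simp only [abs_of_pos hx.1]
  calc ∫⁻ x in Ioo 0 Real.pi, G |fold (x - ξ)|
      ≤ ∫⁻ x in Ioc 0 (0 + 2 * Real.pi), G |fold (x - ξ)| := lintegral_mono_set hsub
    _ = ∫⁻ x in Ioc (-Real.pi) (-Real.pi + 2 * Real.pi), G |fold x| :=
        lintegral_Ioc_comp_sub hper ξ (-Real.pi)
    _ = ∫⁻ x in Ioo (-Real.pi) Real.pi, G |x| := by
        have : -Real.pi + 2 * Real.pi = Real.pi := by ring
        rw [this, setLIntegral_congr Ioo_ae_eq_Ioc.symm]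
        exact setLIntegral_congr_fun measurableSet_Ioo fun x hx => by simp only [fold_eq_self hx]
    _ ≤ ∫⁻ x in Ioc (-Real.pi) 0 ∪ Ioo 0 Real.pi, G |x| := by
        refine lintegral_mono_set fun x hx => ?_
        rcases le_or_gt x 0 with h | h
        · exact Or.inl ⟨hx.1, h⟩
        · exact Or.inr ⟨h, hx.2⟩
    _ ≤ (∫⁻ x in Ioc (-Real.pi) 0, G |x|) + ∫⁻ x in Ioo 0 Real.pi, G |x| :=
        lintegral_union_le _ _ _
    _ = 2 * ∫⁻ x in Ioo 0 Real.pi, G x := by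
        rw [setLIntegral_congr Ioo_ae_eq_Ioc.symm, hneg, hpos, two_mul]

theorem lintegral_Omega_fold_sub_le {G : ℝ × ℝ → ENNReal} (hG : Measurable G) (ζ : ℝ × ℝ) :
    ∫⁻ z in Omega, G (|fold (z.1 - ζ.1)|, |fold (z.2 - ζ.2)|) ≤ 4 * ∫⁻ z in Omega, G z := by
  have hf : ∀ c : ℝ, Measurable fun x => |fold (x - c)| := fun c =>
    measurable_abs.comp (measurable_fold.comp (measurable_id.sub_const c))
  have hm : Measurable fun z : ℝ × ℝ => G (|fold (z.1 - ζ.1)|, |fold (z.2 - ζ.2)|) :=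
    hG.comp (((hf ζ.1).comp measurable_fst).prodMk ((hf ζ.2).comp measurable_snd))
  rw [volume_restrict_Omega, lintegral_prod _ hm.aemeasurable, lintegral_prod _ hG.aemeasurable]
  calc ∫⁻ x in Ioo 0 Real.pi, ∫⁻ y in Ioo 0 Real.pi, G (|fold (x - ζ.1)|, |fold (y - ζ.2)|)
      ≤ ∫⁻ x in Ioo 0 Real.pi, 2 * ∫⁻ y in Ioo 0 Real.pi, G (|fold (x - ζ.1)|, y) :=
        lintegral_mono fun x => lintegral_fold_sub_le (fun y => G (|fold (x - ζ.1)|, y)) ζ.2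
    _ = 2 * ∫⁻ x in Ioo 0 Real.pi, ∫⁻ y in Ioo 0 Real.pi, G (|fold (x - ζ.1)|, y) :=
        lintegral_const_mul' _ _ (by simp)
    _ ≤ 2 * (2 * ∫⁻ x in Ioo 0 Real.pi, ∫⁻ y in Ioo 0 Real.pi, G (x, y)) := by
        gcongr
        exact lintegral_fold_sub_le (fun x => ∫⁻ y in Ioo 0 Real.pi, G (x, y)) ζ.1
    _ = 4 * ∫⁻ x in Ioo 0 Real.pi, ∫⁻ y in Ioo 0 Real.pi, G (x, y) := by
        rw [← mul_assoc]
        norm_num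

theorem lintegral_oddExt_sub_le {u : ℝ × ℝ → ℝ} (hu : Measurable u) (ζ : ℝ × ℝ) :
    ∫⁻ z in Omega, ‖oddExt u (z - ζ)‖ₑ ≤ 4 * ∫⁻ z in Omega, ‖u z‖ₑ := by
  refine le_trans (lintegral_mono fun z => ?_)
    (lintegral_Omega_fold_sub_le (G := fun z => ‖u z‖ₑ) hu.enorm ζ)
  rw [← ofReal_norm, ← ofReal_norm]
  refine ENNReal.ofReal_le_ofReal ?_
  simp only [oddExt, Prod.fst_sub, Prod.snd_sub, Real.norm_eq_abs, abs_mul]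
  have h1 := mul_le_mul (abs_sign_le_one (fold (z.1 - ζ.1))) (abs_sign_le_one (fold (z.2 - ζ.2)))
    (abs_nonneg _) zero_le_one
  calc _ ≤ 1 * 1 * |u (|fold (z.1 - ζ.1)|, |fold (z.2 - ζ.2)|)| :=
        mul_le_mul_of_nonneg_right h1 (abs_nonneg _)
    _ = _ := by ring

/-- The integrand of `∫_Ω (φ * u) ψ`, as a function on `Ω × ℝ²`. -/
def convIntegrand (φ ψ u : ℝ × ℝ → ℝ) (p : (ℝ × ℝ) × (ℝ × ℝ)) : ℝ :=
  φ p.2 * oddExt u (p.1 - p.2) * ψ p.1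

/-- The pairing `∫_Ω (φ * u) ψ`, as an integral over `Ω × ℝ²`. -/
def convForm (φ ψ u : ℝ × ℝ → ℝ) : ℝ :=
  ∫ p, convIntegrand φ ψ u p ∂((volume.restrict Omega).prod volume)

section ConvForm

variable {φ ψ : ℝ × ℝ → ℝ}

theorem aestronglyMeasurable_convIntegrand (hφ : Integrable φ) (hψ : Continuous ψ)
    {u : ℝ × ℝ → ℝ} (hu : Measurable u) : AEStronglyMeasurable (convIntegrand φ ψ u)
      ((volume.restrict Omega).prod volume) :=
  (hφ.aestronglyMeasurable.comp_snd.mul ((measurable_oddExt hu).comp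
    (measurable_fst.sub measurable_snd)).aestronglyMeasurable).mul
    (hψ.comp continuous_fst).aestronglyMeasurable

theorem lintegral_convIntegrand_le (hφ : Integrable φ) (hψ : Continuous ψ) {M : ℝ}
    (hM : ∀ z ∈ Omega, |ψ z| ≤ M) {u : ℝ × ℝ → ℝ} (hu : Measurable u) :
    ∫⁻ p, ‖convIntegrand φ ψ u p‖ₑ ∂((volume.restrict Omega).prod volume) ≤
      (∫⁻ ζ, ‖φ ζ‖ₑ) * (ENNReal.ofReal M * (4 * ∫⁻ z in Omega, ‖u z‖ₑ)) := by
  rw [lintegral_prod_symm _ (aestronglyMeasurable_convIntegrand hφ hψ hu).enorm,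
    ← lintegral_mul_const'' _ hφ.aestronglyMeasurable.enorm]
  refine lintegral_mono fun ζ => ?_
  calc ∫⁻ z in Omega, ‖convIntegrand φ ψ u (z, ζ)‖ₑ
      ≤ ∫⁻ z in Omega, ‖φ ζ‖ₑ * (ENNReal.ofReal M * ‖oddExt u (z - ζ)‖ₑ) := by
        refine lintegral_mono_ae ?_
        filter_upwards [ae_restrict_mem measurableSet_Omega] with z hz
        rw [convIntegrand, enorm_mul, enorm_mul, mul_assoc, mul_comm (ENNReal.ofReal M)]
        gcongr
        rw [← ofReal_norm]
        exact ENNReal.ofReal_le_ofReal (hM z hz)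
    _ = ‖φ ζ‖ₑ * (ENNReal.ofReal M * ∫⁻ z in Omega, ‖oddExt u (z - ζ)‖ₑ) := by
        rw [lintegral_const_mul' _ _ enorm_ne_top, lintegral_const_mul' _ _ ENNReal.ofReal_ne_top]
    _ ≤ _ := by
        gcongr
        exact lintegral_oddExt_sub_le hu ζ

theorem integrable_convIntegrand (hφ : Integrable φ) (hψ : Continuous ψ) {M : ℝ}
    (hM : ∀ z ∈ Omega, |ψ z| ≤ M) {u : ℝ × ℝ → ℝ} (hu : Measurable u)
    (hui : Integrable u (volume.restrict Omega)) :
    Integrable (convIntegrand φ ψ u) ((volume.restrict Omega).prod volume) := by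
  refine ⟨aestronglyMeasurable_convIntegrand hφ hψ hu,
    (lintegral_convIntegrand_le hφ hψ hM hu).trans_lt ?_⟩
  exact ENNReal.mul_lt_top hφ.2 (ENNReal.mul_lt_top ENNReal.ofReal_lt_top
    (ENNReal.mul_lt_top (by simp) hui.2))

theorem integral_conv_mul (hφ : Integrable φ) (hψ : Continuous ψ) {M : ℝ}
    (hM : ∀ z ∈ Omega, |ψ z| ≤ M) {u : ℝ × ℝ → ℝ} (hu : Measurable u)
    (hui : Integrable u (volume.restrict Omega)) :
    Integrable (fun z => conv φ u z * ψ z) (volume.restrict Omega) ∧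
      ∫ z in Omega, conv φ u z * ψ z = convForm φ ψ u := by
  have hint := integrable_convIntegrand hφ hψ hM hu hui
  have heq : ∀ z, conv φ u z * ψ z = ∫ ζ, convIntegrand φ ψ u (z, ζ) := fun z =>
    (integral_mul_const (ψ z) fun ζ => φ ζ * oddExt u (z - ζ)).symm
  simp only [heq]
  exact ⟨hint.integral_prod_left, (integral_prod _ hint).symm⟩

theorem abs_convForm_le (hφ : Integrable φ) (hψ : Continuous ψ) {M : ℝ} (hM0 : 0 ≤ M)
    (hM : ∀ z ∈ Omega, |ψ z| ≤ M) {u : ℝ × ℝ → ℝ} (hu : Measurable u)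
    (hui : Integrable u (volume.restrict Omega)) :
    |convForm φ ψ u| ≤ (∫ ζ, |φ ζ|) * (M * (4 * ∫ z in Omega, |u z|)) := by
  have h1 : ∫⁻ ζ, ‖φ ζ‖ₑ = ENNReal.ofReal (∫ ζ, |φ ζ|) :=
    (ofReal_integral_norm_eq_lintegral_enorm hφ).symm
  have h2 : ∫⁻ z in Omega, ‖u z‖ₑ = ENNReal.ofReal (∫ z in Omega, |u z|) :=
    (ofReal_integral_norm_eq_lintegral_enorm hui).symm
  have h3 := lintegral_convIntegrand_le hφ hψ hM hu
  rw [← ofReal_integral_norm_eq_lintegral_enorm (integrable_convIntegrand hφ hψ hM hu hui), h1, h2,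
    show (4 : ENNReal) = ENNReal.ofReal 4 by simp, ← ENNReal.ofReal_mul (by norm_num),
    ← ENNReal.ofReal_mul hM0, ← ENNReal.ofReal_mul (integral_nonneg fun _ => abs_nonneg _)] at h3
  have h4 := (ENNReal.ofReal_le_ofReal_iff (mul_nonneg (integral_nonneg fun _ => abs_nonneg _)
    (mul_nonneg hM0 (mul_nonneg (by norm_num) (integral_nonneg fun _ => abs_nonneg _))))).1 h3
  exact (norm_integral_le_integral_norm _).trans h4

theorem convForm_add (hφ : Integrable φ) (hψ : Continuous ψ) {M : ℝ}
    (hM : ∀ z ∈ Omega, |ψ z| ≤ M) {u v : ℝ × ℝ → ℝ} (hu : Measurable u) (hv : Measurable v)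
    (hui : Integrable u (volume.restrict Omega)) (hvi : Integrable v (volume.restrict Omega)) :
    convForm φ ψ (u + v) = convForm φ ψ u + convForm φ ψ v := by
  rw [convForm, convForm, convForm, ← integral_add (integrable_convIntegrand hφ hψ hM hu hui)
    (integrable_convIntegrand hφ hψ hM hv hvi)]
  refine integral_congr_ae (Eventually.of_forall fun p => ?_)
  simp only [convIntegrand, oddExt, Pi.add_apply]
  ring

theorem convForm_const_mul (c : ℝ) (u : ℝ × ℝ → ℝ) :
    convForm φ ψ (fun z => c * u z) = c * convForm φ ψ u := by
  rw [convForm, convForm, ← integral_const_mul]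
  refine integral_congr_ae (Eventually.of_forall fun p => ?_)
  simp only [convIntegrand, oddExt]
  ring

/-- Changing `u` on a null set of `Ω` does not change the form, although `oddExt u` depends on the
values of `u` at every point. -/
theorem convForm_congr_ae (hφ : Integrable φ) (hψ : Continuous ψ) {M : ℝ} (hM0 : 0 ≤ M)
    (hM : ∀ z ∈ Omega, |ψ z| ≤ M) {u v : ℝ × ℝ → ℝ} (hu : Measurable u) (hv : Measurable v)
    (hvi : Integrable v (volume.restrict Omega)) (huv : u =ᵐ[volume.restrict Omega] v) :
    convForm φ ψ u = convForm φ ψ v := by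
  have h0 : u - v =ᵐ[volume.restrict Omega] 0 := by
    filter_upwards [huv] with z hz
    simp [hz]
  have hi : Integrable (u - v) (volume.restrict Omega) :=
    (integrable_zero _ _ _).congr h0.symm
  have h1 := abs_convForm_le hφ hψ hM0 hM (hu.sub hv) hi
  have h2 : ∫ z in Omega, |(u - v) z| = 0 := by
    rw [← integral_zero (ℝ × ℝ) ℝ (μ := volume.restrict Omega)]
    refine integral_congr_ae ?_
    filter_upwards [h0] with z hz
    simp [hz]
  rw [h2, mul_zero, mul_zero, mul_zero] at h1
  have h3 := convForm_add hφ hψ hM (hu.sub hv) hv hi hvi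
  rw [sub_add_cancel, abs_nonpos_iff.1 h1, zero_add] at h3
  exact h3

theorem measurable_L2 (f : L2) : Measurable f := (Lp.stronglyMeasurable f).measurable

theorem integrable_L2 (f : L2) : Integrable f (volume.restrict Omega) :=
  (Lp.memLp f).integrable (by norm_num)

theorem exists_integral_abs_le : ∃ C : ℝ, ∀ f : L2, ∫ z in Omega, |f z| ≤ C * ‖f‖ := by
  let one : L2 := (memLp_Omega_of_continuous (continuous_const (y := (1 : ℝ)))).toLp _
  refine ⟨‖one‖, fun f => ?_⟩
  have h1 : ∫ z in Omega, |f z| = inner ℝ one |f| := by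
    rw [inner_L2_eq]
    refine integral_congr_ae ?_
    filter_upwards [(memLp_Omega_of_continuous (continuous_const (y := (1 : ℝ)))).coeFn_toLp,
      Lp.coeFn_abs f] with z hz1 hz2
    rw [hz1, hz2, one_mul]
  rw [h1, ← norm_abs_eq_norm f]
  exact real_inner_le_norm _ _

/-- The form `u ↦ ∫_Ω (φ * u) ψ` is continuous on `L²(Ω)`. -/
theorem exists_convCLM (hφ : Integrable φ) (hψ : Continuous ψ) {M : ℝ} (hM0 : 0 ≤ M)
    (hM : ∀ z ∈ Omega, |ψ z| ≤ M) : ∃ ℓ : L2 →L[ℝ] ℝ, ∀ f : L2, ℓ f = convForm φ ψ f := by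
  obtain ⟨C, hC⟩ := exists_integral_abs_le
  let ℓ : L2 →ₗ[ℝ] ℝ :=
    { toFun := fun f => convForm φ ψ f
      map_add' := fun f g => by
        rw [← convForm_add hφ hψ hM (measurable_L2 f) (measurable_L2 g) (integrable_L2 f)
          (integrable_L2 g)]
        exact convForm_congr_ae hφ hψ hM0 hM (measurable_L2 _)
          ((measurable_L2 f).add (measurable_L2 g)) ((integrable_L2 f).add (integrable_L2 g))
          (Lp.coeFn_add f g)
      map_smul' := fun c f => by
        rw [RingHom.id_apply, smul_eq_mul, ← convForm_const_mul]
        exact convForm_congr_ae hφ hψ hM0 hM (measurable_L2 _)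
          ((measurable_L2 f).const_mul c) ((integrable_L2 f).const_mul c) (Lp.coeFn_smul c f) }
  refine ⟨ℓ.mkContinuous ((∫ ζ, |φ ζ|) * (M * (4 * C))) fun f => ?_, fun f => rfl⟩
  refine (abs_convForm_le hφ hψ hM0 hM (measurable_L2 f) (integrable_L2 f)).trans ?_
  have h0 : 0 ≤ ∫ ζ, |φ ζ| := integral_nonneg fun _ => abs_nonneg _
  calc (∫ ζ, |φ ζ|) * (M * (4 * ∫ z in Omega, |f z|))
      ≤ (∫ ζ, |φ ζ|) * (M * (4 * (C * ‖f‖))) := by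
        gcongr
        exact hC f
    _ = _ := by ring

end ConvForm

theorem sign_mul_sin_abs (p : ℕ) (x : ℝ) :
    Real.sign (fold x) * Real.sin (p * |fold x|) = Real.sin (p * x) := by
  have h1 : Real.sign (fold x) * Real.sin (p * |fold x|) = Real.sin (p * fold x) := by
    rcases lt_trichotomy (fold x) 0 with h | h | h
    · rw [Real.sign_of_neg h, abs_of_neg h, mul_neg, Real.sin_neg]
      ring
    · rw [h]
      simp
    · rw [Real.sign_of_pos h, abs_of_pos h, one_mul]
  have h2 : fold x = x - toIcoDiv Real.two_pi_pos (-Real.pi) x • (2 * Real.pi) := rfl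
  have h3 : (p : ℝ) * fold x =
      p * x - ((p * toIcoDiv Real.two_pi_pos (-Real.pi) x : ℤ) : ℝ) * (2 * Real.pi) := by
    rw [h2, zsmul_eq_mul]
    push_cast
    ring
  rw [h1, h3, Real.sin_sub_int_mul_two_pi]

theorem oddExt_sinMode (k : ℕ × ℕ) : oddExt (sinMode k) = sinMode k := by
  funext z
  rw [oddExt, sinMode, sinMode, ← sign_mul_sin_abs (k.1 + 1) z.1, ← sign_mul_sin_abs (k.2 + 1) z.2]
  ring

/-- A kernel on the plane which is even in each of its two variables. -/
def IsEvenKernel (φ : ℝ × ℝ → ℝ) : Prop :=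
  (∀ x y, φ (-x, y) = φ (x, y)) ∧ ∀ x y, φ (x, -y) = φ (x, y)

/-- The eigenvalue `∬ φ(x, y) cos(px) cos(qy)` of the convolution with `φ` for `sinMode k`. -/
def symbol (φ : ℝ × ℝ → ℝ) (k : ℕ × ℕ) : ℝ :=
  ∫ ζ : ℝ × ℝ, φ ζ * (Real.cos ((k.1 + 1 : ℕ) * ζ.1) * Real.cos ((k.2 + 1 : ℕ) * ζ.2))

theorem integral_comp_neg_fst (F : ℝ × ℝ → ℝ) : ∫ z : ℝ × ℝ, F (-z.1, z.2) = ∫ z, F z := by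
  have h : MeasurePreserving ((MeasurableEquiv.neg ℝ).prodCongr (MeasurableEquiv.refl ℝ))
      (volume : Measure (ℝ × ℝ)) volume :=
    (Measure.measurePreserving_neg volume).prod (MeasurePreserving.id volume)
  exact h.integral_comp' F

theorem integral_comp_neg_snd (F : ℝ × ℝ → ℝ) : ∫ z : ℝ × ℝ, F (z.1, -z.2) = ∫ z, F z := by
  have h : MeasurePreserving ((MeasurableEquiv.refl ℝ).prodCongr (MeasurableEquiv.neg ℝ))
      (volume : Measure (ℝ × ℝ)) volume :=
    (MeasurePreserving.id volume).prod (Measure.measurePreserving_neg volume)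
  exact h.integral_comp' F

theorem integral_eq_zero_of_odd_fst {F : ℝ × ℝ → ℝ} (hF : ∀ x y, F (-x, y) = -F (x, y)) :
    ∫ z, F z = 0 := by
  have h1 := integral_comp_neg_fst F
  simp only [hF, integral_neg] at h1
  linarith

theorem integral_eq_zero_of_odd_snd {F : ℝ × ℝ → ℝ} (hF : ∀ x y, F (x, -y) = -F (x, y)) :
    ∫ z, F z = 0 := by
  have h1 := integral_comp_neg_snd F
  simp only [hF, integral_neg] at h1
  linarith

theorem integrable_mul_of_abs_le_one {φ h : ℝ × ℝ → ℝ} (hφ : Integrable φ) (hh : Continuous h)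
    (hb : ∀ z, |h z| ≤ 1) : Integrable fun z => φ z * h z := by
  simp only [mul_comm (φ _)]
  exact hφ.bdd_mul hh.aestronglyMeasurable (Eventually.of_forall hb)

theorem abs_mul_le_one {a b : ℝ} (ha : |a| ≤ 1) (hb : |b| ≤ 1) : |a * b| ≤ 1 := by
  rw [abs_mul]
  exact mul_le_one₀ ha (abs_nonneg _) hb

/-- In the expansion of `sin(p(x - ξ)) sin(q(y - ζ))` only the term with both cosines of the
integration variables is not odd in one of them. -/
theorem conv_sinMode {φ : ℝ × ℝ → ℝ} (hφ : Integrable φ) (he : IsEvenKernel φ) (k : ℕ × ℕ)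
    (z : ℝ × ℝ) : conv φ (sinMode k) z = symbol φ k * sinMode k z := by
  have hconv : conv φ (sinMode k) z = ∫ ζ, φ ζ * sinMode k (z - ζ) := by
    rw [conv, oddExt_sinMode]
    rfl
  set p : ℝ := ((k.1 + 1 : ℕ) : ℝ)
  set q : ℝ := ((k.2 + 1 : ℕ) : ℝ)
  have hcc : Integrable fun ζ : ℝ × ℝ => φ ζ * (Real.cos (p * ζ.1) * Real.cos (q * ζ.2)) :=
    integrable_mul_of_abs_le_one hφ (by fun_prop) fun ζ =>
      abs_mul_le_one (Real.abs_cos_le_one _) (Real.abs_cos_le_one _)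
  have hcs : Integrable fun ζ : ℝ × ℝ => φ ζ * (Real.cos (p * ζ.1) * Real.sin (q * ζ.2)) :=
    integrable_mul_of_abs_le_one hφ (by fun_prop) fun ζ =>
      abs_mul_le_one (Real.abs_cos_le_one _) (Real.abs_sin_le_one _)
  have hsc : Integrable fun ζ : ℝ × ℝ => φ ζ * (Real.sin (p * ζ.1) * Real.cos (q * ζ.2)) :=
    integrable_mul_of_abs_le_one hφ (by fun_prop) fun ζ =>
      abs_mul_le_one (Real.abs_sin_le_one _) (Real.abs_cos_le_one _)
  have hss : Integrable fun ζ : ℝ × ℝ => φ ζ * (Real.sin (p * ζ.1) * Real.sin (q * ζ.2)) :=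
    integrable_mul_of_abs_le_one hφ (by fun_prop) fun ζ =>
      abs_mul_le_one (Real.abs_sin_le_one _) (Real.abs_sin_le_one _)
  have zcs : ∫ ζ : ℝ × ℝ, φ ζ * (Real.cos (p * ζ.1) * Real.sin (q * ζ.2)) = 0 :=
    integral_eq_zero_of_odd_snd fun x y => by simp only [he.2, mul_neg, Real.sin_neg]
  have zsc : ∫ ζ : ℝ × ℝ, φ ζ * (Real.sin (p * ζ.1) * Real.cos (q * ζ.2)) = 0 :=
    integral_eq_zero_of_odd_fst fun x y => by
      simp only [he.1, mul_neg, Real.sin_neg, neg_mul]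
  have zss : ∫ ζ : ℝ × ℝ, φ ζ * (Real.sin (p * ζ.1) * Real.sin (q * ζ.2)) = 0 :=
    integral_eq_zero_of_odd_fst fun x y => by
      simp only [he.1, mul_neg, Real.sin_neg, neg_mul]
  have hexp : ∀ ζ : ℝ × ℝ, φ ζ * sinMode k (z - ζ) =
      2 / Real.pi * (Real.sin (p * z.1) * Real.sin (q * z.2)) *
          (φ ζ * (Real.cos (p * ζ.1) * Real.cos (q * ζ.2)))
        - 2 / Real.pi * (Real.sin (p * z.1) * Real.cos (q * z.2)) *
          (φ ζ * (Real.cos (p * ζ.1) * Real.sin (q * ζ.2)))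
        - 2 / Real.pi * (Real.cos (p * z.1) * Real.sin (q * z.2)) *
          (φ ζ * (Real.sin (p * ζ.1) * Real.cos (q * ζ.2)))
        + 2 / Real.pi * (Real.cos (p * z.1) * Real.cos (q * z.2)) *
          (φ ζ * (Real.sin (p * ζ.1) * Real.sin (q * ζ.2))) := by
    intro ζ
    rw [sinMode, Prod.fst_sub, Prod.snd_sub, mul_sub, mul_sub, Real.sin_sub, Real.sin_sub]
    ring
  have hlin : ∀ {A B C D : ℝ × ℝ → ℝ} (a b c d : ℝ), Integrable A → Integrable B → Integrable C →
      Integrable D → ∫ ζ, (a * A ζ - b * B ζ - c * C ζ + d * D ζ) =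
        (∫ ζ, a * A ζ) - (∫ ζ, b * B ζ) - (∫ ζ, c * C ζ) + ∫ ζ, d * D ζ := by
    intro A B C D a b c d hA hB hC hD
    have h1 : Integrable fun ζ => a * A ζ - b * B ζ := (hA.const_mul a).sub (hB.const_mul b)
    have h2 : Integrable fun ζ => a * A ζ - b * B ζ - c * C ζ := h1.sub (hC.const_mul c)
    rw [integral_add h2 (hD.const_mul d), integral_sub h1 (hC.const_mul c),
      integral_sub (hA.const_mul a) (hB.const_mul b)]
  simp only [hconv, hexp]
  rw [hlin _ _ _ _ hcc hcs hsc hss, integral_const_mul, integral_const_mul,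
    integral_const_mul, integral_const_mul, zcs, zsc, zss, symbol, sinMode]
  ring

/-- Parseval's identity for the convolution, which is diagonal in the sine basis. -/
theorem hasSum_conv {φ : ℝ × ℝ → ℝ} (hφ : Integrable φ) (he : IsEvenKernel φ) (u : L2)
    {ψ : ℝ × ℝ → ℝ} (hψ : Continuous ψ) {g : L2} (hg : g =ᵐ[volume.restrict Omega] ψ) :
    Integrable (fun z => conv φ u z * ψ z) (volume.restrict Omega) ∧
    HasSum (fun k => symbol φ k * coeff k u * coeff k g) (∫ z in Omega, conv φ u z * ψ z) := by
  obtain ⟨M, hM⟩ := (isCompact_Icc.prod isCompact_Icc :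
    IsCompact (Icc 0 Real.pi ×ˢ Icc 0 Real.pi)).exists_bound_of_continuousOn hψ.continuousOn
  have hM' : ∀ z ∈ Omega, |ψ z| ≤ M := fun z hz =>
    hM z ⟨Ioo_subset_Icc_self hz.1, Ioo_subset_Icc_self hz.2⟩
  have hM0 : 0 ≤ M := (norm_nonneg _).trans
    (hM (0, 0) ⟨⟨le_rfl, Real.pi_pos.le⟩, ⟨le_rfl, Real.pi_pos.le⟩⟩)
  obtain ⟨ℓ, hℓ⟩ := exists_convCLM hφ hψ hM0 hM'
  have hconv := integral_conv_mul hφ hψ hM' (measurable_L2 u) (integrable_L2 u)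
  refine ⟨hconv.1, ?_⟩
  rw [hconv.2, ← hℓ]
  refine ((hasSum_coeff_smul u).mapL ℓ).congr_fun fun k => ?_
  have hmode : Integrable (sinMode k) (volume.restrict Omega) :=
    (memLp_Omega_of_continuous (continuous_sinMode k)).integrable (by norm_num)
  have h1 : ℓ (sinL2 k) = symbol φ k * coeff k g := by
    rw [hℓ, convForm_congr_ae hφ hψ hM0 hM' (measurable_L2 _) (continuous_sinMode k).measurable
      hmode (coeFn_sinL2 k), ← (integral_conv_mul hφ hψ hM' (continuous_sinMode k).measurable
      hmode).2, coeff_eq_of_ae hg, ← integral_const_mul]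
    refine integral_congr_ae (Eventually.of_forall fun z => ?_)
    simp only [conv_sinMode hφ he]
    ring
  rw [map_smul, h1, smul_eq_mul]
  ring

theorem abs_symbol_le {φ : ℝ × ℝ → ℝ} (hφ : Integrable φ) (k : ℕ × ℕ) :
    |symbol φ k| ≤ ∫ ζ, |φ ζ| := by
  refine (norm_integral_le_integral_norm _).trans (integral_mono_of_nonneg
    (Eventually.of_forall fun ζ => norm_nonneg (_ : ℝ)) hφ.abs (Eventually.of_forall fun ζ => ?_))
  simp only [Real.norm_eq_abs]
  rw [abs_mul]
  exact mul_le_of_le_one_right (abs_nonneg _)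
    (abs_mul_le_one (Real.abs_cos_le_one _) (Real.abs_cos_le_one _))

/-! ### Gaussian kernels and square kernels -/

theorem symbol_mul_kernel (f g : ℝ → ℝ) (k : ℕ × ℕ) :
    symbol (fun z => f z.1 * g z.2) k =
      (∫ x, f x * Real.cos ((k.1 + 1 : ℕ) * x)) * ∫ x, g x * Real.cos ((k.2 + 1 : ℕ) * x) := by
  rw [symbol, ← integral_prod_mul]
  refine integral_congr_ae (Eventually.of_forall fun z => ?_)
  simp only
  ring

/-- The integral is the real part of the Fourier integral of the Gaussian, which is a Gaussian. -/
theorem integral_gaussian_mul_cos_pos {α : ℝ} (hα : 0 < α) (p : ℝ) :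
    0 < ∫ x, Real.exp (-α * x ^ 2) * Real.cos (p * x) := by
  have hα' : 0 < (α : ℂ).re := by simpa using hα
  have h1 := fourierIntegral_gaussian hα' (p : ℂ)
  have hcexp : ∀ x : ℝ, Complex.exp (Complex.I * p * x) * Complex.exp (-(α : ℂ) * (x : ℂ) ^ 2) =
      ((Real.exp (-α * x ^ 2) : ℝ) : ℂ) * Complex.exp (((p * x : ℝ) : ℂ) * Complex.I) := by
    intro x
    push_cast
    rw [mul_comm]
    congr 2
    ring
  simp only [hcexp] at h1
  have hint : Integrable fun x : ℝ =>
      ((Real.exp (-α * x ^ 2) : ℝ) : ℂ) * Complex.exp (((p * x : ℝ) : ℂ) * Complex.I) := by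
    have h2 := integrable_cexp_quadratic hα' (Complex.I * p) 0
    refine h2.congr (Eventually.of_forall fun x => ?_)
    simp only
    rw [← hcexp, ← Complex.exp_add]
    congr 1
    ring
  have hre := integral_re hint
  have heq : ∀ x : ℝ, RCLike.re (((Real.exp (-α * x ^ 2) : ℝ) : ℂ) *
      Complex.exp (((p * x : ℝ) : ℂ) * Complex.I)) = Real.exp (-α * x ^ 2) * Real.cos (p * x) := by
    intro x
    rw [RCLike.re_eq_complex_re, Complex.re_ofReal_mul, Complex.exp_ofReal_mul_I_re]
  simp only [heq] at hre
  have hval : ((Real.pi : ℂ) / α) ^ (1 / 2 : ℂ) * Complex.exp (-(p : ℂ) ^ 2 / (4 * α)) =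
      (((Real.pi / α) ^ (1 / 2 : ℝ) * Real.exp (-p ^ 2 / (4 * α)) : ℝ) : ℂ) := by
    push_cast
    rw [Complex.ofReal_cpow (by positivity)]
    push_cast
    rfl
  rw [hre, h1, hval, RCLike.re_eq_complex_re, Complex.ofReal_re]
  positivity

theorem gaussianKernel_eq (α β : ℝ) : gaussianKernel α β =
    fun z => (β * Real.exp (-α * z.1 ^ 2)) * Real.exp (-α * z.2 ^ 2) := by
  funext z
  rw [gaussianKernel, mul_add, Real.exp_add, mul_assoc]

theorem integrable_gaussianKernel {α : ℝ} (hα : 0 < α) (β : ℝ) :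
    Integrable (gaussianKernel α β) := by
  rw [gaussianKernel_eq]
  exact ((integrable_exp_neg_mul_sq hα).const_mul β).mul_prod (integrable_exp_neg_mul_sq hα)

theorem isEvenKernel_gaussianKernel (α β : ℝ) : IsEvenKernel (gaussianKernel α β) :=
  ⟨fun x y => by simp [gaussianKernel], fun x y => by simp [gaussianKernel]⟩

theorem symbol_gaussianKernel_pos {α β : ℝ} (hα : 0 < α) (hβ : 0 < β) (k : ℕ × ℕ) :
    0 < symbol (gaussianKernel α β) k := by
  rw [gaussianKernel_eq, symbol_mul_kernel (fun x => β * Real.exp (-α * x ^ 2))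
    (fun x => Real.exp (-α * x ^ 2))]
  simp only [mul_assoc β, integral_const_mul]
  exact mul_pos hβ (mul_pos (integral_gaussian_mul_cos_pos hα _)
    (integral_gaussian_mul_cos_pos hα _))

/-- The cosine transform of `f * f`, for even `f`, is the square of that of `f`: after
multiplication by the character `exp(ipx)`, this is the integral of a convolution. -/
theorem integral_convolution_mul_cos {f : ℝ → ℝ} (hf : Integrable f) (he : Function.Even f)
    (p : ℝ) : ∫ x, convolution f f (ContinuousLinearMap.mul ℝ ℝ) volume x * Real.cos (p * x) =
      (∫ x, f x * Real.cos (p * x)) ^ 2 := by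
  set F : ℝ → ℂ := fun x => (f x : ℂ) * Complex.exp (((p * x : ℝ) : ℂ) * Complex.I) with hF
  have hchar : Continuous fun x : ℝ => Complex.exp (((p * x : ℝ) : ℂ) * Complex.I) := by fun_prop
  have hmul : ∀ {g : ℝ → ℝ}, Integrable g →
      Integrable fun x => (g x : ℂ) * Complex.exp (((p * x : ℝ) : ℂ) * Complex.I) := by
    intro g hg
    simp only [mul_comm (g _ : ℂ)]
    refine hg.ofReal.bdd_mul (c := 1) hchar.aestronglyMeasurable (Eventually.of_forall fun x => ?_)
    rw [Complex.norm_exp_ofReal_mul_I]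
  have hre : ∀ {g : ℝ → ℝ}, Integrable g →
      (∫ x, (g x : ℂ) * Complex.exp (((p * x : ℝ) : ℂ) * Complex.I)).re =
        ∫ x, g x * Real.cos (p * x) := by
    intro g hg
    rw [← RCLike.re_eq_complex_re, ← integral_re (hmul hg)]
    refine integral_congr_ae (Eventually.of_forall fun x => ?_)
    simp only [RCLike.re_eq_complex_re, Complex.re_ofReal_mul, Complex.exp_ofReal_mul_I_re]
  have him : (∫ x, F x).im = 0 := by
    rw [← RCLike.im_eq_complex_im, ← integral_im (hmul hf)]
    have h1 : ∀ x, RCLike.im (F x) = f x * Real.sin (p * x) := fun x => by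
      rw [RCLike.im_eq_complex_im, hF, Complex.im_ofReal_mul, Complex.exp_ofReal_mul_I_im]
    have h2 := integral_neg_eq_self (fun x => f x * Real.sin (p * x)) volume
    simp only [he _, mul_neg, Real.sin_neg, integral_neg] at h2
    simp only [hF] at h1
    simp only [h1]
    linarith
  have hconv : ∀ x, convolution F F (ContinuousLinearMap.mul ℝ ℂ) volume x =
      ((convolution f f (ContinuousLinearMap.mul ℝ ℝ) volume x : ℝ) : ℂ) *
        Complex.exp (((p * x : ℝ) : ℂ) * Complex.I) := by
    intro x
    rw [convolution, convolution, ← integral_complex_ofReal, ← integral_mul_const]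
    refine integral_congr_ae (Eventually.of_forall fun t => ?_)
    have h1 : Complex.exp (((p * x : ℝ) : ℂ) * Complex.I) =
        Complex.exp (((p * t : ℝ) : ℂ) * Complex.I) *
          Complex.exp (((p * (x - t) : ℝ) : ℂ) * Complex.I) := by
      rw [← Complex.exp_add]
      congr 1
      push_cast
      ring
    simp only [ContinuousLinearMap.mul_apply', hF]
    rw [h1, Complex.ofReal_mul (f t)]
    ring
  have hff : Integrable (convolution f f (ContinuousLinearMap.mul ℝ ℝ) volume) :=
    hf.integrable_convolution (ContinuousLinearMap.mul ℝ ℝ) hf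
  have h1 := integral_convolution (ContinuousLinearMap.mul ℝ ℂ) (hmul hf) (hmul hf)
    (μ := volume) (ν := volume)
  have h2 := congrArg Complex.re h1
  simp only [← hF] at h2
  simp only [hconv] at h2
  rw [hre hff, ContinuousLinearMap.mul_apply', Complex.mul_re, him, hF, hre hf] at h2
  rw [h2]
  ring

theorem even_convolution {f : ℝ → ℝ} (he : Function.Even f) (x : ℝ) :
    convolution f f (ContinuousLinearMap.mul ℝ ℝ) volume (-x) =
      convolution f f (ContinuousLinearMap.mul ℝ ℝ) volume x :=
  convolution_neg_of_neg_eq _ (Eventually.of_forall he) (Eventually.of_forall he)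

theorem integrable_squareKernel {f : ℝ → ℝ} (hf : Integrable f) : Integrable (squareKernel f) :=
  (hf.integrable_convolution (ContinuousLinearMap.mul ℝ ℝ) hf).mul_prod
    (hf.integrable_convolution (ContinuousLinearMap.mul ℝ ℝ) hf)

theorem isEvenKernel_squareKernel {f : ℝ → ℝ} (he : Function.Even f) :
    IsEvenKernel (squareKernel f) :=
  ⟨fun x y => by simp only [squareKernel, even_convolution he],
    fun x y => by simp only [squareKernel, even_convolution he]⟩

theorem symbol_squareKernel_nonneg {f : ℝ → ℝ} (hf : Integrable f) (he : Function.Even f)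
    (k : ℕ × ℕ) : 0 ≤ symbol (squareKernel f) k := by
  have h : symbol (squareKernel f) k = _ := symbol_mul_kernel _ _ k
  rw [h, integral_convolution_mul_cos hf he, integral_convolution_mul_cos hf he]
  positivity

theorem kernelCoeff_eq (φ : ℝ × ℝ → ℝ) (k : ℕ × ℕ) :
    kernelCoeff φ (k.1 + 1) (k.2 + 1) = 1 / (2 * Real.pi) ^ 2 * symbol φ k := rfl

theorem symbol_pos_of_kernelCoeff_pos {φ : ℝ × ℝ → ℝ}
    (h : ∀ p q : ℕ, 1 ≤ p → 1 ≤ q → 0 < kernelCoeff φ p q) (k : ℕ × ℕ) : 0 < symbol φ k := by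
  have h1 := h (k.1 + 1) (k.2 + 1) (by omega) (by omega)
  rw [kernelCoeff_eq] at h1
  exact pos_of_mul_pos_right h1 (by positivity)

/-! ### The dynamics of the sine modes -/

/-- The Cauchy–Schwarz inequality for a weighted series, with `ℓ²` bounds on finite partial sums. -/
theorem abs_le_of_hasSum_mul {ι : Type*} {m x y : ι → ℝ} {C S X Y : ℝ} (hC : 0 ≤ C)
    (hm : ∀ i, |m i| ≤ C) (hx : ∀ F : Finset ι, ∑ i ∈ F, x i ^ 2 ≤ X)
    (hy : ∀ F : Finset ι, ∑ i ∈ F, y i ^ 2 ≤ Y) (hS : HasSum (fun i => m i * x i * y i) S) :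
    |S| ≤ C * (Real.sqrt X * Real.sqrt Y) := by
  refine le_of_tendsto hS.abs (Eventually.of_forall fun F => ?_)
  calc |∑ i ∈ F, m i * x i * y i| ≤ ∑ i ∈ F, |m i * x i * y i| := Finset.abs_sum_le_sum_abs _ _
    _ ≤ ∑ i ∈ F, C * (|x i| * |y i|) := by
        refine Finset.sum_le_sum fun i _ => ?_
        rw [abs_mul, abs_mul, mul_assoc]
        exact mul_le_mul_of_nonneg_right (hm i) (by positivity)
    _ = C * ∑ i ∈ F, |x i| * |y i| := by rw [Finset.mul_sum]
    _ ≤ C * (Real.sqrt (∑ i ∈ F, |x i| ^ 2) * Real.sqrt (∑ i ∈ F, |y i| ^ 2)) := by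
        gcongr
        exact Real.sum_mul_le_sqrt_mul_sqrt F _ _
    _ ≤ C * (Real.sqrt X * Real.sqrt Y) := by
        simp only [sq_abs]
        gcongr
        · exact hx F
        · exact hy F

theorem sum_coeff_sq_le (f : L2) (F : Finset (ℕ × ℕ)) : ∑ k ∈ F, coeff k f ^ 2 ≤ ‖f‖ ^ 2 :=
  sum_le_hasSum F (fun _ _ => sq_nonneg _) (hasSum_coeff_sq f)

theorem sum_sqrt_eigenvalue_mul_sq_le {U : L2 × L2 × L2} (hU : U ∈ H10) (F : Finset (ℕ × ℕ)) :
    ∑ k ∈ F, (Real.sqrt (eigenvalue k) * coeff k U.1) ^ 2 ≤ gradSq U := by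
  refine le_trans (le_of_eq (Finset.sum_congr rfl fun k _ => ?_)) (sum_eigenvalue_mul_sq_le hU F)
  rw [mul_pow, Real.sq_sqrt (eigenvalue_pos k).le]

section Dynamics

variable {grav hbar : ℝ} {φv φh : ℝ × ℝ → ℝ} {U : ℝ → L2 × L2 × L2} {w : ℝ → L2}

/-- The stiffness of the mode `k`, an oscillator with displacement `coeff k u`. -/
def stiffness (grav hbar : ℝ) (φv : ℝ × ℝ → ℝ) (k : ℕ × ℕ) : ℝ :=
  eigenvalue k * (grav * hbar + hbar * symbol φv k)

/-- The elastic term of the equation in the sine basis, where the Laplacian is moved from `v` to the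
sine functions. -/
theorem hasSum_elastic_term (hv : Integrable φv) (hve : IsEvenKernel φv) (u : L2)
    {V : L2 × L2 × L2} {v : ℝ × ℝ → ℝ} (hvt : IsTest v) (hV : Represents V v) :
    HasSum (fun k => -(stiffness grav hbar φv k * coeff k u * coeff k V.1))
      (∫ z in Omega, (grav * hbar * u z + hbar * conv φv u z) * lap v z) := by
  set g : L2 := hvt.memLp_lap.toLp (lap v)
  have hg : g =ᵐ[volume.restrict Omega] lap v := hvt.memLp_lap.coeFn_toLp
  have h1 := hasSum_conv hv hve u (contDiff_lap hvt.1).continuous hg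
  have h2 : ∫ z in Omega, u z * lap v z = ∫ z in Omega, u z * g z := by
    refine integral_congr_ae ?_
    filter_upwards [hg] with z hz
    rw [hz]
  have h3 : ∫ z in Omega, (grav * hbar * u z + hbar * conv φv u z) * lap v z =
      grav * hbar * (∫ z in Omega, u z * g z) + hbar * ∫ z in Omega, conv φv u z * lap v z := by
    rw [← h2, ← integral_const_mul, ← integral_const_mul, ← integral_add
      ((integrable_L2_mul hvt.memLp_lap).const_mul _) (h1.1.const_mul _)]
    refine integral_congr_ae (Eventually.of_forall fun z => ?_)
    simp only
    ring
  rw [h3]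
  refine (((hasSum_coeff_mul u g).mul_left (grav * hbar)).add
    (h1.2.mul_left hbar)).congr_fun fun k => ?_
  rw [hvt.coeff_lap hV.1, stiffness]
  ring

/-- The right-hand side of the equation, tested with `v`, tends to the one tested with `sinMode k`
as `v` tends to `sinMode k` in the `H¹` norm, uniformly for bounded `(u, w)`. -/
theorem abs_rhs_sub_le (hhbar : 0 < hbar) (hgrav : 0 < grav) (hv : Integrable φv)
    (hve : IsEvenKernel φv) (hh : Integrable φh) (hhe : IsEvenKernel φh)
    {T : L2 × L2 × L2} (hT : T ∈ H10) (y : L2) (k : ℕ × ℕ) {V : L2 × L2 × L2}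
    {v : ℝ × ℝ → ℝ} (hvt : IsTest v) (hV : Represents V v) {E : L2 × L2 × L2} (hE : E ∈ H10)
    (hEk : E.1 = sinL2 k) :
    |((∫ z in Omega, (grav * hbar * T.1 z + hbar * conv φv T.1 z) * lap v z)
        - ∫ z in Omega, conv φh y z * v z)
      - (-(stiffness grav hbar φv k * coeff k T.1) - symbol φh k * coeff k y)| ≤
    (grav * hbar + hbar * ∫ ζ, |φv ζ|) * (Real.sqrt (gradSq T) * Real.sqrt (gradSq (V - E)))
      + (∫ ζ, |φh ζ|) * (‖y‖ * ‖(V - E).1‖) := by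
  have hD : V - E ∈ H10 := sub_mem_H10 (mem_H10_of_isTest hvt hV) hE
  have hDk : ∀ l, coeff l (V - E).1 = coeff l V.1 - if l = k then 1 else 0 := fun l => by
    rw [Prod.fst_sub, map_sub, hEk, coeff_sinL2]
  have hsingle : ∀ c : ℕ × ℕ → ℝ, HasSum (fun l => c l * if l = k then 1 else 0) (c k) := by
    intro c
    convert hasSum_ite_eq k (c k) using 2 with l
    split_ifs with h
    · rw [h, mul_one]
    · rw [mul_zero]
  -- Splitting the eigenvalue into two square roots pairs the `H¹` norms of `T` and of `V - E`.
  have hA : HasSum (fun l => -((grav * hbar + hbar * symbol φv l)) *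
      (Real.sqrt (eigenvalue l) * coeff l T.1) * (Real.sqrt (eigenvalue l) * coeff l (V - E).1))
      ((∫ z in Omega, (grav * hbar * T.1 z + hbar * conv φv T.1 z) * lap v z) -
        -(stiffness grav hbar φv k * coeff k T.1)) := by
    refine ((hasSum_elastic_term hv hve T.1 hvt hV).sub
      (hsingle fun l => -(stiffness grav hbar φv l * coeff l T.1))).congr_fun fun l => ?_
    have h1 := Real.mul_self_sqrt (eigenvalue_pos l).le
    rw [hDk, stiffness]
    linear_combination (-(grav * hbar + hbar * symbol φv l) * coeff l T.1 *
      (coeff l V.1 - if l = k then 1 else 0)) * h1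
  have hB : HasSum (fun l => symbol φh l * coeff l y * coeff l (V - E).1)
      ((∫ z in Omega, conv φh y z * v z) - symbol φh k * coeff k y) := by
    refine ((hasSum_conv hh hhe y hvt.continuous hV.1).2.sub
      (hsingle fun l => symbol φh l * coeff l y)).congr_fun fun l => ?_
    rw [hDk]
    ring
  have hA' := abs_le_of_hasSum_mul (C := grav * hbar + hbar * ∫ ζ, |φv ζ|)
    (add_nonneg (by positivity) (mul_nonneg hhbar.le (integral_nonneg fun _ => abs_nonneg _)))
    (fun l => by
      rw [abs_neg]
      refine (abs_add_le _ _).trans ?_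
      rw [abs_of_pos (mul_pos hgrav hhbar), abs_mul, abs_of_pos hhbar]
      have := abs_symbol_le hv l
      gcongr) (sum_sqrt_eigenvalue_mul_sq_le hT)
    (sum_sqrt_eigenvalue_mul_sq_le hD) hA
  have hB' := abs_le_of_hasSum_mul (integral_nonneg fun _ => abs_nonneg _)
    (fun l => abs_symbol_le hh l) (sum_coeff_sq_le y) (sum_coeff_sq_le (V - E).1) hB
  rw [Real.sqrt_sq (norm_nonneg _), Real.sqrt_sq (norm_nonneg _)] at hB'
  refine le_trans ?_ (add_le_add hA' hB')
  refine le_trans (le_of_eq ?_) (abs_sub _ _)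
  congr 1
  ring

theorem IsErrorSolution.hasDerivAt_coeff_fst (h : IsErrorSolution grav hbar φv φh U w)
    (k : ℕ × ℕ) {t : ℝ} (ht : 0 < t) :
    HasDerivAt (fun s => coeff k (U s).1) (coeff k (w t)) t :=
  (coeff k).hasFDerivAt.comp_hasDerivAt t ((h.hasDeriv t ht.le).hasDerivAt (Ici_mem_nhds ht))

/-- Each sine mode of a solution is a damped oscillator. The sine function is not a test function,
so the equation for it is obtained as a limit of the equation for test functions. -/
theorem IsErrorSolution.hasDerivAt_coeff_snd (h : IsErrorSolution grav hbar φv φh U w)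
    (hhbar : 0 < hbar) (hgrav : 0 < grav) (hv : Integrable φv)
    (hve : IsEvenKernel φv) (hh : Integrable φh) (hhe : IsEvenKernel φh)
    (k : ℕ × ℕ) {t : ℝ} (ht : 0 < t) :
    HasDerivAt (fun s => coeff k (w s))
      (-(stiffness grav hbar φv k * coeff k (U t).1) - symbol φh k * coeff k (w t)) t := by
  set E := smoothTriple (sinMode k) (contDiff_sinMode k) with hEdef
  have hE : E ∈ H10 := smoothTriple_sinMode_mem_H10 k
  have hEk : E.1 = sinL2 k := rfl
  obtain ⟨V, hV, hlim⟩ := mem_closure_iff_seq_limit.1 hE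
  choose v hvt hVv using hV
  have hK : IsCompact (Icc 0 (t + 1)) := isCompact_Icc
  have hsub : Icc 0 (t + 1) ⊆ Ici (0 : ℝ) := Icc_subset_Ici_self
  have hcont : ContinuousOn (fun s => Real.sqrt (gradSq (U s))) (Icc 0 (t + 1)) :=
    (Real.continuous_sqrt.comp continuous_gradSq).comp_continuousOn (h.continuousOn_U.mono hsub)
  obtain ⟨B₁, hB₁⟩ := hK.exists_bound_of_continuousOn hcont
  obtain ⟨B₂, hB₂⟩ := hK.exists_bound_of_continuousOn (h.continuousOn_w.mono hsub)
  have hD : Tendsto (fun n => V n - E) atTop (𝓝 0) := by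
    simpa using hlim.sub_const E
  have hg : Tendsto (fun n => Real.sqrt (gradSq (V n - E))) atTop (𝓝 0) := by
    have := ((Real.continuous_sqrt.comp continuous_gradSq).tendsto (0 : L2 × L2 × L2)).comp hD
    simpa [gradSq, Function.comp_def] using this
  have hn : Tendsto (fun n => ‖(V n - E).1‖) atTop (𝓝 0) := by
    have := ((continuous_norm.comp continuous_fst).tendsto (0 : L2 × L2 × L2)).comp hD
    simpa [Function.comp_def] using this
  have hφv : 0 ≤ grav * hbar + hbar * ∫ ζ, |φv ζ| :=
    add_nonneg (by positivity) (mul_nonneg hhbar.le (integral_nonneg fun _ => abs_nonneg _))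
  have hφh : 0 ≤ ∫ ζ, |φh ζ| := integral_nonneg fun _ => abs_nonneg _
  have herr : Tendsto (fun n => (grav * hbar + hbar * ∫ ζ, |φv ζ|) *
      (B₁ * Real.sqrt (gradSq (V n - E))) + (∫ ζ, |φh ζ|) * (B₂ * ‖(V n - E).1‖)) atTop (𝓝 0) := by
    simpa using ((hg.const_mul B₁).const_mul (grav * hbar + hbar * ∫ ζ, |φv ζ|)).add
      ((hn.const_mul B₂).const_mul (∫ ζ, |φh ζ|))
  refine hasDerivAt_of_tendstoUniformlyOn (l := atTop) (s := Ioo 0 (t + 1))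
    (f := fun n s => ∫ z in Omega, w s z * v n z)
    (f' := fun n s => (∫ z in Omega, (grav * hbar * (U s).1 z + hbar * conv φv (U s).1 z) *
      lap (v n) z) - ∫ z in Omega, conv φh (w s) z * v n z)
    (g' := fun s => -(stiffness grav hbar φv k * coeff k (U s).1) - symbol φh k * coeff k (w s))
    isOpen_Ioo ?_ ?_ ?_ ⟨ht, by linarith⟩
  · rw [Metric.tendstoUniformlyOn_iff]
    intro ε hε
    filter_upwards [herr.eventually_lt_const hε] with n hn s hs
    have hs' := Ioo_subset_Icc_self hs
    rw [dist_comm, Real.dist_eq]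
    refine lt_of_le_of_lt ((abs_rhs_sub_le hhbar hgrav hv hve hh hhe (h.mem_H10 s hs.1.le) (w s) k
      (hvt n) (hVv n) hE hEk).trans ?_) hn
    have h1 := (le_abs_self _).trans (hB₁ s hs')
    have h2 := hB₂ s hs'
    gcongr
  · exact Eventually.of_forall fun n s hs =>
      (h.equation (v n) (hvt n) s hs.1.le).hasDerivAt (Ici_mem_nhds hs.1)
  · intro s _
    have h1 : ∀ n, ∫ z in Omega, w s z * v n z = inner ℝ (w s) (V n).1 := by
      intro n
      rw [inner_L2_eq]
      refine integral_congr_ae ?_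
      filter_upwards [(hVv n).1] with z hz
      rw [hz]
    have h2 : coeff k (w s) = inner ℝ (w s) E.1 := by
      rw [hEk, real_inner_comm]
      rfl
    simp only [h1, h2]
    exact ((innerSL ℝ (w s)).continuous.comp continuous_fst).tendsto E |>.comp hlim

theorem IsErrorSolution.continuousOn_coeff_fst (h : IsErrorSolution grav hbar φv φh U w)
    (k : ℕ × ℕ) : ContinuousOn (fun t => coeff k (U t).1) (Ici 0) :=
  ((coeff k).continuous.comp continuous_fst).comp_continuousOn h.continuousOn_U

theorem IsErrorSolution.continuousOn_coeff_snd (h : IsErrorSolution grav hbar φv φh U w)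
    (k : ℕ × ℕ) : ContinuousOn (fun t => coeff k (w t)) (Ici 0) :=
  (coeff k).continuous.comp_continuousOn h.continuousOn_w

theorem normH_eq (T : L2 × L2 × L2) (y : L2) : normH T y = Real.sqrt (gradSq T + ‖y‖ ^ 2) := by
  rw [normH, gradSq, norm_sq_eq_integral, norm_sq_eq_integral, norm_sq_eq_integral]
  have hsq : ∀ f : L2, Integrable (fun z => f z * f z) (volume.restrict Omega) := fun f =>
    integrable_L2_mul (Lp.memLp f)
  have h1 : Integrable (fun z => T.2.1 z * T.2.1 z + T.2.2 z * T.2.2 z) (volume.restrict Omega) :=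
    (hsq _).add (hsq _)
  rw [← integral_add (hsq _) (hsq _), ← integral_add h1 (hsq _)]
  simp only [sq]

/-- Stability for general even kernels, in terms of the symbols of the convolutions: the energies
of the sine modes decrease to zero, and their initial values are summable. -/
theorem stronglyAsymptoticallyStable_of_symbol (hgrav : 0 < grav) (hhbar : 0 < hbar)
    (hv : Integrable φv) (hve : IsEvenKernel φv) (hvs : ∀ k, 0 ≤ symbol φv k)
    (hh : Integrable φh) (hhe : IsEvenKernel φh) (hhs : ∀ k, 0 < symbol φh k) :
    StronglyAsymptoticallyStable grav hbar φv φh := by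
  intro U w h
  set c : ℕ × ℕ → ℝ := stiffness grav hbar φv with hc
  set e : ℝ → ℕ × ℕ → ℝ := fun t k => c k * coeff k (U t).1 ^ 2 + coeff k (w t) ^ 2 with he
  have hgh : 0 < grav * hbar := mul_pos hgrav hhbar
  have hcle : ∀ k, grav * hbar * eigenvalue k ≤ c k := fun k => by
    have := mul_nonneg (eigenvalue_pos k).le (mul_nonneg hhbar.le (hvs k))
    simp only [hc, stiffness]
    linarith
  have hcpos : ∀ k, 0 < c k := fun k => (mul_pos hgh (eigenvalue_pos k)).trans_le (hcle k)
  have hcge : ∀ k, c k ≤ (grav * hbar + hbar * ∫ ζ, |φv ζ|) * eigenvalue k := fun k => by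
    have := (le_abs_self _).trans (abs_symbol_le hv k)
    have := mul_le_mul_of_nonneg_left (mul_le_mul_of_nonneg_left this hhbar.le)
      (eigenvalue_pos k).le
    simp only [hc, stiffness]
    linarith
  have hnonneg : ∀ t k, 0 ≤ e t k := fun t k =>
    add_nonneg (mul_nonneg (hcpos k).le (sq_nonneg _)) (sq_nonneg _)
  have hsum : ∀ t, 0 ≤ t → Summable (e t) := by
    intro t ht
    refine Summable.add (Summable.of_nonneg_of_le
      (fun k => mul_nonneg (hcpos k).le (sq_nonneg _)) (fun k => ?_)
      ((summable_eigenvalue_mul_sq (h.mem_H10 t ht)).mul_left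
        (grav * hbar + hbar * ∫ ζ, |φv ζ|))) (hasSum_coeff_sq (w t)).summable
    rw [← mul_assoc]
    exact mul_le_mul_of_nonneg_right (hcge k) (sq_nonneg _)
  have hlim : Tendsto (fun t => ∑' k, e t k) atTop (𝓝 (∑' _ : ℕ × ℕ, (0 : ℝ))) := by
    refine tendsto_tsum_of_dominated_convergence (hsum 0 le_rfl) (fun k => ?_) ?_
    · exact oscillator_energy_tendsto_zero (hcpos k) (hhs k) (h.continuousOn_coeff_fst k)
        (h.continuousOn_coeff_snd k) (fun t ht => h.hasDerivAt_coeff_fst k ht)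
        fun t ht => h.hasDerivAt_coeff_snd hhbar hgrav hv hve hh hhe k ht
    · filter_upwards [eventually_ge_atTop 0] with t ht k
      rw [Real.norm_of_nonneg (hnonneg t k)]
      exact oscillator_energy_antitoneOn (hhs k) (h.continuousOn_coeff_fst k)
        (h.continuousOn_coeff_snd k) (fun t ht => h.hasDerivAt_coeff_fst k ht)
        (fun t ht => h.hasDerivAt_coeff_snd hhbar hgrav hv hve hh hhe k ht)
        (mem_Ici.2 le_rfl) (mem_Ici.2 ht) ht
  rw [tsum_zero] at hlim
  set D : ℝ := 2 / (grav * hbar) + 1 with hD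
  have hbound : ∀ t, 0 ≤ t → gradSq (U t) + ‖w t‖ ^ 2 ≤ D * ∑' k, e t k := by
    intro t ht
    have h1 := ((summable_eigenvalue_mul_sq (h.mem_H10 t ht)).hasSum.mul_left 2).add
      (hasSum_coeff_sq (w t))
    have h2 := (hsum t ht).hasSum.mul_left D
    refine le_trans (add_le_add_left (gradSq_le_two_mul_tsum (h.mem_H10 t ht)) _)
      (hasSum_le (fun k => ?_) h1 h2)
    have h3 : eigenvalue k * coeff k (U t).1 ^ 2 ≤ c k * coeff k (U t).1 ^ 2 / (grav * hbar) := by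
      rw [le_div_iff₀ hgh]
      have := mul_le_mul_of_nonneg_right (hcle k) (sq_nonneg (coeff k (U t).1))
      linarith
    have h4 : 0 ≤ c k * coeff k (U t).1 ^ 2 := mul_nonneg (hcpos k).le (sq_nonneg _)
    have h5 : 0 ≤ 2 / (grav * hbar) * coeff k (w t) ^ 2 := by positivity
    have h6 : D * e t k = 2 * (c k * coeff k (U t).1 ^ 2 / (grav * hbar)) +
        2 / (grav * hbar) * coeff k (w t) ^ 2 + c k * coeff k (U t).1 ^ 2 +
        coeff k (w t) ^ 2 := by
      simp only [hD, he]
      ring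
    rw [h6]
    linarith
  have hsq : Tendsto (fun t => gradSq (U t) + ‖w t‖ ^ 2) atTop (𝓝 0) := by
    refine tendsto_of_tendsto_of_tendsto_of_le_of_le' tendsto_const_nhds
      (by simpa using hlim.const_mul D) ?_ ?_
    · exact Eventually.of_forall fun t => add_nonneg (gradSq_nonneg _) (sq_nonneg _)
    · filter_upwards [eventually_ge_atTop 0] with t ht using hbound t ht
  simp only [normH_eq]
  simpa [Function.comp_def] using (Real.continuous_sqrt.tendsto 0).comp hsq

end Dynamics

end WaveObserver

end

theorem theorem1 (grav hbar : ℝ) (hgrav : 0 < grav) (hhbar : 0 < hbar) :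
    (∀ αv βv αh βh : ℝ, 0 < αv → 0 < βv → 0 < αh → 0 < βh →
      WaveObserver.StronglyAsymptoticallyStable grav hbar
        (WaveObserver.gaussianKernel αv βv) (WaveObserver.gaussianKernel αh βh)) ∧
    (∀ fv fh : ℝ → ℝ, MeasureTheory.Integrable fv → MeasureTheory.Integrable fh →
      Function.Even fv → Function.Even fh →
      (∀ p q : ℕ, 1 ≤ p → 1 ≤ q →
        0 < WaveObserver.kernelCoeff (WaveObserver.squareKernel fh) p q) →
      WaveObserver.StronglyAsymptoticallyStable grav hbar
        (WaveObserver.squareKernel fv) (WaveObserver.squareKernel fh)) := by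
  constructor
  · intro αv βv αh βh hαv hβv hαh hβh
    exact WaveObserver.stronglyAsymptoticallyStable_of_symbol hgrav hhbar
      (WaveObserver.integrable_gaussianKernel hαv βv)
      (WaveObserver.isEvenKernel_gaussianKernel αv βv)
      (fun k => (WaveObserver.symbol_gaussianKernel_pos hαv hβv k).le)
      (WaveObserver.integrable_gaussianKernel hαh βh)
      (WaveObserver.isEvenKernel_gaussianKernel αh βh)
      (WaveObserver.symbol_gaussianKernel_pos hαh hβh)
  · intro fv fh hv hh hve hhe hpos
    exact WaveObserver.stronglyAsymptoticallyStable_of_symbol hgrav hhbar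
      (WaveObserver.integrable_squareKernel hv) (WaveObserver.isEvenKernel_squareKernel hve)
      (WaveObserver.symbol_squareKernel_nonneg hv hve)
      (WaveObserver.integrable_squareKernel hh) (WaveObserver.isEvenKernel_squareKernel hhe)
      (WaveObserver.symbol_pos_of_kernelCoeff_pos hpos)
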